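/- Let $R$ be a noetherian normal integral domain with fraction field $K$, and let $A$ be an $R$-algebra which is finitely generated and free as an $R$-module. For a commutative $R$-algebra $S$ put $A^S = S\otimes_R A$, and for a prime $\mathfrak p$ of $R$ put $A(\mathfrak p) = \mathrm{k}(\mathfrak p)\otimes_R A$ with $\mathrm{k}(\mathfrak p)=\mathrm{Frac}(R/\mathfrak p)$. Let $\mathrm{G}_0$ denote the Grothendieck group of finite-dimensional modules of a finite-dimensional algebra. An $A$-gate in $\mathfrak p$ is a local ring $\mathcal O$ with $R\subseteq\mathcal O\subseteq K$ and maximal ideal $\mathfrak m$ such that $R\cap\mathfrak m=\mathfrak p$, such that every finite-dimensional $A^K$-module $V$ has an $\mathcal O$-free $A^{\mathcal O}$-form (an $\mathcal O$-free $A^{\mathcal O}$-module $\widetilde V$ with $A^K\otimes_{A^{\mathcal O}}\widetilde V\cong V$), and such that the classes $[\widetilde V/\mathfrak m\widetilde V]$ of the reductions of all finitely generated $\mathcal O$-free $A^{\mathcal O}$-modules $\widetilde V$ lie in the image of the injective map $\mathrm{G}_0(A(\mathfrak p))\hookrightarrow \mathrm{G}_0(A^{\mathcal O/\mathfrak m})$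 given by scalar extension. The decomposition map $\mathrm{d}_A^{\mathfrak p,\mathcal O}:\mathrm{G}_0(A^K)\to\mathrm{G}_0(A(\mathfrak p))$ is the group morphism which sends $[V]$ to $[\widetilde V/\mathfrak m\widetilde V]$ for every $\mathcal O$-free $A^{\mathcal O}$-form $\widetilde V$ of $V$. It is called trivial if it induces a bijection between the isomorphism classes of simple modules of $A^K$ and those of $A(\mathfrak p)$. Let $\mathrm{DecGen}(A)$ be the set of all $\mathfrak p\in\mathrm{Spec}(R)$ such that there is an $A$-gate in $\mathfrak p$ and $\mathrm{d}_A^{\mathfrak p,\mathcal O}$ is trivial for every $A$-gate $\mathcal O$ in $\mathfrak p$, and let $\mathrm{DecEx}(A)=\mathrm{Spec}(R)\setminus\mathrm{DecGen}(A)$. A decomposition discriminant of $A$ is an ideal of $R$ whose zero locus is $\mathrm{DecEx}(A)$. Suppose that $A$ has split fibers (for every $\mathfrak p\in\mathrm{Spec}(R)$, every endomorphism of every simple $A(\mathfrak p)$-module is a scalar), that $A$ is symmetric with symmetrizing trace $\tau: A\to R$ (an $R$-linear form with $\tau(ab)=\tau(ba)$ such that $a\mapsto\tau(a\,\cdot\,)$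 is an isomorphism $A\to\mathrm{Hom}_R(A,R)$), and that $A^K$ is semisimple. Let $(S_i)_{i\in I}$ be a system of representatives of the isomorphism classes of simple $A^K$-modules, and let $c_i$ be the Schur element of $S_i$, i.e. the unique element of $K$ such that $\sum_j b_j\,\varphi(b_j^\vee v)=c_i\,\mathrm{Tr}(\varphi)\,v$ for all $\varphi\in\mathrm{End}_K(S_i)$, $v\in S_i$ and all bases $(b_j)$, $(b_j^\vee)$ of $A^K$ that are dual with respect to the extension $\tau^K$ of $\tau$ to $A^K$. Then all Schur elements $c_i$ exist and lie in $R$, and $$\mathrm{DecEx}(A)=\bigcup_{i\in I}\mathrm{V}(c_i)=\mathrm{V}\Big(\prod_{i\in I}c_i\Big).$$ In particular, the principal ideal generated by the product $\prod_{i\in I} c_i$ of the Schur elements is a decomposition discriminant of $A$, and every decomposition discriminant of $A$ has the same radical as this ideal. -/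

import Mathlib

open scoped TensorProduct

universe u v

namespace DecompositionMap

/-! ### Modules that are finite over the base ring, and Grothendieck groups -/

/-- A module over the `S`-algebra `B` which is finitely generated over the commutative ring `S`.
For a finite-dimensional algebra `B` over a field `S` these are the finite-dimensional
`B`-modules. (The `S`-module structure is the one induced by `S → B`, see `tower`.) -/
structure FinMod (S B : Type u) [CommRing S] [Ring B] [Algebra S B] where
  carrier : Type u
  [addCommGroup : AddCommGroup carrier]
  [baseModule : Module S carrier]
  [module : Module B carrier]
  [tower : IsScalarTower S B carrier]
  [finite : Module.Finite S carrier]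

attribute [instance] FinMod.addCommGroup FinMod.baseModule FinMod.module FinMod.tower FinMod.finite

instance (S B : Type u) [CommRing S] [Ring B] [Algebra S B] : CoeSort (FinMod S B) (Type u) :=
  ⟨FinMod.carrier⟩

section Grothendieck

variable (S B : Type u) [CommRing S] [Ring B] [Algebra S B]

/-- The relations `[M] - [M'] - [M'']` for all short exact sequences `0 → M' → M → M'' → 0`. -/
def shortExactRelations : Set (FreeAbelianGroup (FinMod S B)) :=
  {x | ∃ (M' M M'' : FinMod S B) (f : M' →ₗ[B] M) (g : M →ₗ[B] M''),
    Function.Injective f ∧ Function.Exact f g ∧ Function.Surjective g ∧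
    x = FreeAbelianGroup.of M - FreeAbelianGroup.of M' - FreeAbelianGroup.of M''}

/-- The Grothendieck group `G₀(B)` of the category of `B`-modules that are finite over `S`. -/
def G0 : Type (u + 1) :=
  FreeAbelianGroup (FinMod S B) ⧸ AddSubgroup.closure (shortExactRelations S B)

instance : AddCommGroup (G0 S B) :=
  inferInstanceAs (AddCommGroup
    (FreeAbelianGroup (FinMod S B) ⧸ AddSubgroup.closure (shortExactRelations S B)))

variable {S B}

/-- The class `[M]` in `G₀(B)`. -/
def G0.of (M : FinMod S B) : G0 S B :=
  QuotientAddGroup.mk' (AddSubgroup.closure (shortExactRelations S B)) (FreeAbelianGroup.of M)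

variable (S B) in
/-- The set of classes of simple modules in `G₀(B)`. -/
def simpleClasses : Set (G0 S B) :=
  {x | ∃ M : FinMod S B, IsSimpleModule B M ∧ x = G0.of M}

end Grothendieck

/-! ### Scalar extension of modules along `A^S → A^{S'}` -/

section BaseChange

variable {R A S : Type u} (S' : Type u) [CommRing R] [Ring A] [Algebra R A] [CommRing S]
  [Algebra R S] [CommRing S'] [Algebra R S'] [Algebra S S'] [IsScalarTower R S S']

/-- The action of `A^{S'} = S' ⊗[R] A` on `S' ⊗[S] M` for an `A^S`-module `M`:
`(s ⊗ a) • (t ⊗ m) = (s * t) ⊗ ((1 ⊗ a) • m)`. -/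
noncomputable def extAction (M : FinMod S (S ⊗[R] A)) :
    S' ⊗[R] A →ₐ[S'] Module.End S' (S' ⊗[S] M) :=
  Algebra.TensorProduct.lift (Algebra.ofId S' _)
    { ((Module.End.baseChangeHom S S' M).comp (Algebra.lsmul S S M)).toRingHom.comp
        (Algebra.TensorProduct.includeRight : A →ₐ[R] S ⊗[R] A).toRingHom with
      commutes' := by
        intro r
        have h : (1 : S) ⊗ₜ[R] algebraMap R A r = algebraMap S (S ⊗[R] A) (algebraMap R S r) := by
          rw [Algebra.TensorProduct.algebraMap_apply, Algebra.algebraMap_self_apply,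
            Algebra.algebraMap_eq_smul_one, Algebra.algebraMap_eq_smul_one,
            TensorProduct.smul_tmul]
        refine LinearMap.ext fun x ↦ ?_
        change (Algebra.lsmul S S M ((1 : S) ⊗ₜ[R] algebraMap R A r)).baseChange S' x = r • x
        rw [h]
        induction x with
        | zero => simp
        | add x y hx hy => rw [map_add, hx, hy, smul_add]
        | tmul t m =>
          rw [LinearMap.baseChange_tmul, Algebra.lsmul_coe]
          change t ⊗ₜ[S] (algebraMap S (S ⊗[R] A) (algebraMap R S r) • m) = r • t ⊗ₜ[S] m
          rw [algebraMap_smul, TensorProduct.tmul_smul, algebraMap_smul] }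
    (fun x y ↦ Algebra.commutes x _)

theorem extAction_tmul (M : FinMod S (S ⊗[R] A)) (s t : S') (a : A) (m : M) :
    extAction S' M (s ⊗ₜ a) (t ⊗ₜ m) = (s * t) ⊗ₜ (((1 : S) ⊗ₜ[R] a) • m) := by
  rfl

/-- The scalar extension `A^{S'} ⊗_{A^S} M` of an `A^S`-module `M`, realized as `S' ⊗[S] M`. -/
noncomputable def FinMod.baseChange (M : FinMod S (S ⊗[R] A)) : FinMod S' (S' ⊗[R] A) where
  carrier := S' ⊗[S] M
  module := Module.compHom _ (extAction S' M).toRingHom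
  tower := by
    let _ := Module.compHom (S' ⊗[S] M) (extAction S' M).toRingHom
    refine ⟨fun s b x ↦ ?_⟩
    change extAction S' M (s • b) x = s • extAction S' M b x
    rw [map_smul, LinearMap.smul_apply]

/-- The scalar extension of a homomorphism of `A^S`-modules. -/
noncomputable def baseChangeMap {M N : FinMod S (S ⊗[R] A)} (f : M →ₗ[S ⊗[R] A] N) :
    M.baseChange S' →ₗ[S' ⊗[R] A] N.baseChange S' where
  toFun := (f.restrictScalars S).baseChange S'
  map_add' := map_add _
  map_smul' b x := by
    suffices h : ∀ (b : S' ⊗[R] A) (x : S' ⊗[S] M),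
        (f.restrictScalars S).baseChange S' (extAction S' M b x) =
          extAction S' N b ((f.restrictScalars S).baseChange S' x) from h b x
    intro b x
    induction b with
    | zero => simp
    | add b c hb hc => simp [hb, hc]
    | tmul s a =>
      induction x with
      | zero => simp
      | add x y hx hy => rw [map_add, map_add, map_add, map_add, hx, hy]
      | tmul t m => simp [extAction_tmul]

/-- The map `G₀(A^S) → G₀(A^{S'})`, `[M] ↦ [A^{S'} ⊗ M]`, induced by a flat ring extension `S → S'`;
in particular by an extension of fields. -/
noncomputable def G0.ext [Module.Flat S S'] : G0 S (S ⊗[R] A) →+ G0 S' (S' ⊗[R] A) :=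
  QuotientAddGroup.lift _ (FreeAbelianGroup.lift fun M ↦ G0.of (M.baseChange S')) <| by
    rw [AddSubgroup.closure_le]
    rintro _ ⟨M', M, M'', f, g, hf, hfg, hg, rfl⟩
    simp only [SetLike.mem_coe, AddMonoidHom.mem_ker, map_sub, FreeAbelianGroup.lift_apply_of]
    have key : FreeAbelianGroup.of (M.baseChange S') - FreeAbelianGroup.of (M'.baseChange S') -
        FreeAbelianGroup.of (M''.baseChange S') ∈
          AddSubgroup.closure (shortExactRelations S' (S' ⊗[R] A)) := by
      refine AddSubgroup.subset_closure ⟨_, _, _, baseChangeMap S' f, baseChangeMap S' g,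
        ?_, ?_, ?_, rfl⟩
      · exact Module.Flat.lTensor_preserves_injective_linearMap (M := S') (f.restrictScalars S) hf
      · exact Module.Flat.lTensor_exact (R := S) S' (f := f.restrictScalars S)
          (g := g.restrictScalars S) hfg
      · exact LinearMap.lTensor_surjective S' (g := g.restrictScalars S) hg
    have := (QuotientAddGroup.eq_zero_iff _).2 key
    exact this

end BaseChange

/-! ### Gates and decomposition maps -/

section Gates

variable (R A : Type u) {K : Type u} [CommRing R] [Field K] [Algebra R K] [Ring A] [Algebra R A]

/-- The inclusion `k(𝔭) → k(𝔪)` of residue fields for a local ring `O` between `R` and `K` whose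
maximal ideal `𝔪` satisfies `R ∩ 𝔪 = 𝔭`. -/
noncomputable def residueMap (p : PrimeSpectrum R) (O : Subalgebra R K) [IsLocalRing O]
    (h : (IsLocalRing.maximalIdeal O).comap (algebraMap R O) = p.asIdeal) :
    p.asIdeal.ResidueField →ₐ[R] IsLocalRing.ResidueField O :=
  Ideal.ResidueField.liftₐ p.asIdeal (Algebra.ofId R (IsLocalRing.ResidueField O))
    (by
      intro r hr
      rw [← h] at hr
      exact (IsLocalRing.residue_eq_zero_iff _).2 hr)
    (by
      intro r hr
      have hr' : algebraMap R O r ∉ IsLocalRing.maximalIdeal O := fun hm ↦ hr (h ▸ hm)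
      have : IsLocalRing.residue O (algebraMap R O r) ≠ 0 :=
        fun h0 ↦ hr' ((IsLocalRing.residue_eq_zero_iff _).1 h0)
      exact IsUnit.mk0 _ this)

/-- The map `G₀(A(𝔭)) → G₀(A^O(𝔪))` induced by `k(𝔭) → k(𝔪)`. -/
noncomputable def gamma (p : PrimeSpectrum R) (O : Subalgebra R K) [IsLocalRing O]
    (h : (IsLocalRing.maximalIdeal O).comap (algebraMap R O) = p.asIdeal) :
    G0 p.asIdeal.ResidueField (p.asIdeal.ResidueField ⊗[R] A) →+
      G0 (IsLocalRing.ResidueField O) (IsLocalRing.ResidueField O ⊗[R] A) :=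
  letI := (residueMap R p O h).toRingHom.toAlgebra
  haveI : IsScalarTower R p.asIdeal.ResidueField (IsLocalRing.ResidueField O) :=
    IsScalarTower.of_algebraMap_eq fun r ↦ ((residueMap R p O h).commutes r).symm
  G0.ext (IsLocalRing.ResidueField O)

variable {R A}

/-- `W` is an `O`-free `A^O`-form of the `A^K`-module `V`: it is free over `O` and
`A^K ⊗ W ≅ V`. -/
def IsFreeForm (O : Subalgebra R K) (W : FinMod O (O ⊗[R] A)) (V : FinMod K (K ⊗[R] A)) : Prop :=
  Module.Free O W ∧ Nonempty (W.baseChange K ≃ₗ[K ⊗[R] A] V)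

/-- The class in `G₀(A^O(𝔪))` of the reduction `W / 𝔪 W = k(𝔪) ⊗ W` of an `A^O`-module `W`. -/
noncomputable def reductionClass (O : Subalgebra R K) [IsLocalRing O] (W : FinMod O (O ⊗[R] A)) :
    G0 (IsLocalRing.ResidueField O) (IsLocalRing.ResidueField O ⊗[R] A) :=
  G0.of (W.baseChange (IsLocalRing.ResidueField O))

variable (A)

/-- `O` is an `A`-gate in `𝔭`: a local ring between `R` and `K` with maximal ideal `𝔪` such that
`R ∩ 𝔪 = 𝔭`, every finite-dimensional `A^K`-module has an `O`-free `A^O`-form, and the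
reductions of the finitely generated `O`-free `A^O`-modules lie in `G₀(A(𝔭)) ⊆ G₀(A^O(𝔪))`. -/
structure IsGate (p : PrimeSpectrum R) (O : Subalgebra R K) : Prop where
  isLocalRing : IsLocalRing O
  comap_eq : (IsLocalRing.maximalIdeal O).comap (algebraMap R O) = p.asIdeal
  exists_form : ∀ V : FinMod K (K ⊗[R] A), ∃ W : FinMod O (O ⊗[R] A), IsFreeForm O W V
  reduction_mem : ∀ W : FinMod O (O ⊗[R] A), Module.Free O W →
    reductionClass O W ∈ (gamma R A p O comap_eq).range

variable {A}

/-- The characterizing property of the decomposition map `G₀(A^K) → G₀(A(𝔭))` with respect to the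
`A`-gate `O` in `𝔭`: it maps `[V]` to the class of the reduction of any `O`-free form of `V`. -/
def IsDecompositionMap {p : PrimeSpectrum R} {O : Subalgebra R K} (hO : IsGate A p O)
    (d : G0 K (K ⊗[R] A) →+
      G0 p.asIdeal.ResidueField (p.asIdeal.ResidueField ⊗[R] A)) : Prop :=
  haveI := hO.isLocalRing
  ∀ (V : FinMod K (K ⊗[R] A)) (W : FinMod O (O ⊗[R] A)), IsFreeForm O W V →
    gamma R A p O hO.comap_eq (d (G0.of V)) = reductionClass O W

/-- The decomposition map with respect to the gate `O` in `𝔭` is trivial: it induces a bijection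
between the (classes of) simple modules of `A^K` and those of `A(𝔭)`. -/
def HasTrivialDecompositionMap {p : PrimeSpectrum R} {O : Subalgebra R K}
    (hO : IsGate A p O) : Prop :=
  ∃ d : G0 K (K ⊗[R] A) →+ G0 p.asIdeal.ResidueField (p.asIdeal.ResidueField ⊗[R] A),
    IsDecompositionMap hO d ∧
    Set.BijOn d (simpleClasses K (K ⊗[R] A))
      (simpleClasses p.asIdeal.ResidueField (p.asIdeal.ResidueField ⊗[R] A))

variable (R A K)

/-- The set of primes `𝔭` in which there is an `A`-gate and all decomposition maps are trivial. -/
def DecGen : Set (PrimeSpectrum R) :=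
  {p | (∃ O : Subalgebra R K, IsGate A p O) ∧
    ∀ (O : Subalgebra R K) (hO : IsGate A p O), HasTrivialDecompositionMap hO}

/-- The locus of non-trivial decomposition maps. -/
def DecEx : Set (PrimeSpectrum R) := (DecGen R A K)ᶜ

/-- An ideal is a decomposition discriminant of `A` if its zero locus is `DecEx(A)`. -/
def IsDecompositionDiscriminant (d : Ideal R) : Prop :=
  PrimeSpectrum.zeroLocus (d : Set R) = DecEx R A K

end Gates

/-! ### Split, symmetric, Schur elements -/

section Symmetric

/-- A finite-dimensional algebra `B` over a field `k` splits if every endomorphism of every simple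
`B`-module is a scalar. -/
def IsSplit (k B : Type u) [Field k] [Ring B] [Algebra k B] : Prop :=
  ∀ S : FinMod k B, IsSimpleModule B S → ∀ φ : S →ₗ[B] S, ∃ c : k, ∀ v : S, φ v = c • v

/-- `A` has split fibers: `A(𝔭) = k(𝔭) ⊗ A` splits for all primes `𝔭`. -/
def HasSplitFibers (R A : Type u) [CommRing R] [Ring A] [Algebra R A] : Prop :=
  ∀ p : PrimeSpectrum R, IsSplit p.asIdeal.ResidueField (p.asIdeal.ResidueField ⊗[R] A)

/-- A symmetrizing trace on the `R`-algebra `A`: a linear form `τ` with `τ(ab) = τ(ba)` such that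
the bilinear form `(a, b) ↦ τ(ab)` is non-degenerate over `R`, i.e. `a ↦ τ(a ·)` is an
isomorphism from `A` onto its `R`-dual. -/
structure IsSymmetrizingTrace {R A : Type u} [CommRing R] [Ring A] [Algebra R A]
    (τ : A →ₗ[R] R) : Prop where
  map_mul_comm : ∀ a b : A, τ (a * b) = τ (b * a)
  bijective : Function.Bijective fun a : A ↦ τ ∘ₗ LinearMap.mulLeft R a

/-- The scalar extension `τ^K : A^K → K` of a linear form `τ : A → R`. -/
noncomputable def extendTrace {R A : Type u} (K : Type u) [CommRing R] [Ring A] [Algebra R A]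
    [Field K] [Algebra R K] (τ : A →ₗ[R] R) : K ⊗[R] A →ₗ[K] K :=
  (TensorProduct.AlgebraTensorModule.rid R K K).toLinearMap ∘ₗ τ.baseChange K

/-- `c` is the Schur element of the (split) simple module `V` of the symmetric algebra `B` with
symmetrizing trace `t`: for dual bases `(b i)`, `(b' i)` of `B` with respect to `t` and every
`φ ∈ End_k(V)` one has `∑ i, b i φ(b' i v) = c Tr(φ) v`. (Dual bases exist because the form is
non-degenerate, and the condition does not depend on their choice.) -/
def IsSchurElement {k B : Type u} [Field k] [Ring B] [Algebra k B] (t : B →ₗ[k] k)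
    (V : FinMod k B) (c : k) : Prop :=
  ∀ (n : ℕ) (b b' : Module.Basis (Fin n) k B),
    (∀ i j, t (b' i * b j) = if i = j then 1 else 0) →
    ∀ (φ : V →ₗ[k] V) (v : V), ∑ i, b i • φ (b' i • v) = (c * LinearMap.trace k V φ) • v

/-- `(V i)` is a system of representatives of the isomorphism classes of simple `B`-modules. -/
structure IsSimpleSystem {k B : Type u} [Field k] [Ring B] [Algebra k B] {I : Type*}
    (V : I → FinMod k B) : Prop where
  simple : ∀ i, IsSimpleModule B (V i)
  eq_of_iso : ∀ i j, Nonempty (V i ≃ₗ[B] V j) → i = j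
  exists_iso : ∀ M : FinMod k B, IsSimpleModule B M → ∃ i, Nonempty (V i ≃ₗ[B] M)

end Symmetric

end DecompositionMap

/-! Fix bases `b`, `b'` of `A` dual with respect to `τ`. The Casimir operator `φ ↦ ∑ b j ∘ φ ∘ b' j`
turns linear maps into `A`-linear ones. Over `K` it therefore vanishes between non-isomorphic simple
modules and equals `c i * Tr φ` on the simple module `V i`. Evaluated on a rank-one map of a free
form over a valuation ring `O`, it shows `c i ∈ O`. Normality of `R` then gives `c i ∈ R`. Because
the fibers split, a valuation ring dominating `R` localized at `𝔭` is a gate in `𝔭`.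

Suppose no `c i` lies in `𝔭`, and let `W i` be free forms over a gate `O`. The `c i` are units of
`O`, so the Casimir formula produces all matrix units and `A^O → ∏ End_O (W i)` is onto
(`repMap_surjective_of_isUnit`). Hence the reductions of the `W i` are simple and pairwise
non-isomorphic, and their squared dimensions add up to the rank of `A`, so they exhaust the simple
modules. By splitness they come from simple modules `T i` of `A(𝔭)`. The decomposition map is
written down using idempotents of `A^O`: the rank of such an idempotent on a free lattice is the
same over `K` and over the residue field (`rankOn_baseChange`).

Conversely, if a decomposition map is trivial, it sends the `V i` to distinct simple modules `T i`
of the same dimension. The sum of squares then makes `A(𝔭)` act faithfully on the `T i`, which are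
all its simple modules. On each `T i` the Casimir operator is nonzero (`exists_casimir_ne_zero`). If
`c i ∈ 𝔭`, it vanishes on the reduction of `W i`, yet this reduction contains a scalar extension of
some `T j`, a contradiction. -/

namespace DecompositionMap

/-! ### Submodules, quotients, and the Grothendieck group -/

section GrothendieckGroup

variable {S B : Type u} [CommRing S] [Ring B] [Algebra S B]

/-- A submodule of a finite module over a noetherian base, as a finite module. -/
noncomputable def FinMod.sub [IsNoetherianRing S] (M : FinMod S B) (N : Submodule B M) :
    FinMod S B where
  carrier := N
  finite := inferInstanceAs (Module.Finite S (N.restrictScalars S))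

/-- The inclusion of a submodule. -/
noncomputable def FinMod.subIncl [IsNoetherianRing S] (M : FinMod S B) (N : Submodule B M) :
    M.sub N →ₗ[B] M := N.subtype

theorem FinMod.subIncl_injective [IsNoetherianRing S] (M : FinMod S B) (N : Submodule B M) :
    Function.Injective (M.subIncl N) := N.subtype_injective

/-- A quotient of a finite module, as a finite module. -/
noncomputable def FinMod.quot (M : FinMod S B) (N : Submodule B M) : FinMod S B where
  carrier := M ⧸ N
  finite := Module.Finite.of_surjective (N.mkQ.restrictScalars S) N.mkQ_surjective

variable (S B) in
/-- The zero module. -/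
noncomputable def FinMod.zero : FinMod S B where
  carrier := PUnit

instance : Subsingleton (FinMod.zero S B) := inferInstanceAs (Subsingleton PUnit)

theorem G0.of_eq_add {M' M M'' : FinMod S B} (f : M' →ₗ[B] M) (g : M →ₗ[B] M'')
    (hf : Function.Injective f) (hfg : Function.Exact f g) (hg : Function.Surjective g) :
    G0.of M = G0.of M' + G0.of M'' := by
  have key : FreeAbelianGroup.of M - FreeAbelianGroup.of M' - FreeAbelianGroup.of M'' ∈
      AddSubgroup.closure (shortExactRelations S B) :=
    AddSubgroup.subset_closure ⟨_, _, _, f, g, hf, hfg, hg, rfl⟩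
  have h : G0.of M - G0.of M' - G0.of M'' = 0 := (QuotientAddGroup.eq_zero_iff _).2 key
  rw [sub_sub, sub_eq_zero] at h
  exact h

theorem G0.of_subsingleton (M : FinMod S B) [Subsingleton M] : G0.of M = 0 := by
  -- On a zero module the sequence of two identities is exact, so `[M] = [M] + [M]`.
  have h := G0.of_eq_add (LinearMap.id : M →ₗ[B] M) (LinearMap.id : M →ₗ[B] M)
    Function.injective_id (fun x ↦ ⟨fun _ ↦ ⟨x, rfl⟩, fun _ ↦ Subsingleton.elim _ _⟩)
    Function.surjective_id
  simpa using h

theorem G0.of_congr {M N : FinMod S B} (e : M ≃ₗ[B] N) : G0.of M = G0.of N := by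
  have h := G0.of_eq_add e.toLinearMap (0 : N →ₗ[B] FinMod.zero S B) e.injective
    (fun x ↦ ⟨fun _ ↦ e.surjective x, fun _ ↦ rfl⟩) (fun x ↦ ⟨0, Subsingleton.elim _ _⟩)
  rw [h, G0.of_subsingleton (FinMod.zero S B), add_zero]

theorem G0.of_eq_sub_add_quot [IsNoetherianRing S] (M : FinMod S B) (N : Submodule B M) :
    G0.of M = G0.of (M.sub N) + G0.of (M.quot N) :=
  G0.of_eq_add (M' := M.sub N) (M'' := M.quot N) N.subtype N.mkQ N.subtype_injective
    (LinearMap.exact_subtype_mkQ N) N.mkQ_surjective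

/-- An additive invariant of finite modules defines a homomorphism on the Grothendieck group. -/
noncomputable def G0.lift {G : Type*} [AddCommGroup G] (χ : FinMod S B → G)
    (h : ∀ (M' M M'' : FinMod S B) (f : M' →ₗ[B] M) (g : M →ₗ[B] M''),
      Function.Injective f → Function.Exact f g → Function.Surjective g → χ M = χ M' + χ M'') :
    G0 S B →+ G :=
  QuotientAddGroup.lift _ (FreeAbelianGroup.lift χ) <| by
    rw [AddSubgroup.closure_le]
    rintro _ ⟨M', M, M'', f, g, hf, hfg, hg, rfl⟩
    simp [h M' M M'' f g hf hfg hg]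

@[simp]
theorem G0.lift_of {G : Type*} [AddCommGroup G] (χ : FinMod S B → G)
    (h : ∀ (M' M M'' : FinMod S B) (f : M' →ₗ[B] M) (g : M →ₗ[B] M''),
      Function.Injective f → Function.Exact f g → Function.Surjective g → χ M = χ M' + χ M'')
    (M : FinMod S B) : G0.lift χ h (G0.of M) = χ M := by
  change FreeAbelianGroup.lift χ (FreeAbelianGroup.of M) = χ M
  simp

end GrothendieckGroup

/-! ### Dévissage and ranks of idempotents over a field. -/

section Field

variable {k B : Type u} [Field k] [Ring B] [Algebra k B]

theorem FinMod.isArtinian (M : FinMod k B) : IsArtinian B M :=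
  isArtinian_of_tower k inferInstance

theorem FinMod.exists_simple_submodule (M : FinMod k B) [Nontrivial M] :
    ∃ N : Submodule B M, IsSimpleModule B N := by
  have := M.isArtinian
  obtain ⟨N, hN, -⟩ := (eq_bot_or_exists_atom_le (⊤ : Submodule B M)).resolve_left top_ne_bot
  exact ⟨N, isSimpleModule_iff_isAtom.2 hN⟩

theorem finrank_pos_of_simple (M : FinMod k B) (h : IsSimpleModule B M) :
    0 < Module.finrank k M := by
  have := IsSimpleModule.nontrivial B M
  exact Module.finrank_pos

/-- Dévissage: induction on the dimension, splitting off a simple submodule. Applied to an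
equalizer, it also shows that two homomorphisms agreeing on simple classes agree on all classes. -/
theorem G0.of_mem_closure (H : AddSubgroup (G0 k B)) (hH : simpleClasses k B ⊆ H)
    (M : FinMod k B) : G0.of M ∈ H := by
  suffices h : ∀ (n : ℕ) (M : FinMod k B), Module.finrank k M = n → G0.of M ∈ H from
    h _ M rfl
  intro n
  induction n using Nat.strong_induction_on with
  | _ n ih =>
    intro M hM
    rcases subsingleton_or_nontrivial M with hs | hs
    · rw [G0.of_subsingleton]
      exact H.zero_mem
    · obtain ⟨N, hN⟩ := M.exists_simple_submodule
      rw [G0.of_eq_sub_add_quot M N]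
      refine H.add_mem (hH ⟨M.sub N, hN, rfl⟩) (ih _ ?_ (M.quot N) rfl)
      have h1 : Module.finrank k (M ⧸ N.restrictScalars k) +
        Module.finrank k (N.restrictScalars k) = Module.finrank k M :=
        Submodule.finrank_quotient_add_finrank _
      have h2 : 0 < Module.finrank k (M.sub N) := finrank_pos_of_simple (M.sub N) hN
      change Module.finrank k (M ⧸ N.restrictScalars k) < n
      change 0 < Module.finrank k (N.restrictScalars k) at h2
      omega

/-- The rank of an element on a module. -/
noncomputable def rankOn (e : B) (M : FinMod k B) : ℕ :=
  Module.finrank k (LinearMap.range (Algebra.lsmul k k M e))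

theorem mem_range_lsmul_iff {e : B} (he : IsIdempotentElem e) {M : FinMod k B} {x : M} :
    x ∈ LinearMap.range (Algebra.lsmul k k M e) ↔ e • x = x := by
  constructor
  · rintro ⟨y, rfl⟩
    simp [smul_smul, he.eq]
  · intro h
    exact ⟨x, h⟩

/-- The image of an idempotent is its fixed space, so `M ↦ e M` is an exact functor; rank-nullity
for the induced maps gives additivity. -/
theorem rankOn_eq_add {e : B} (he : IsIdempotentElem e) {M' M M'' : FinMod k B}
    (f : M' →ₗ[B] M) (g : M →ₗ[B] M'') (hf : Function.Injective f) (hfg : Function.Exact f g)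
    (hg : Function.Surjective g) : rankOn e M = rankOn e M' + rankOn e M'' := by
  let U' := LinearMap.range (Algebra.lsmul k k M' e)
  let U := LinearMap.range (Algebra.lsmul k k M e)
  let U'' := LinearMap.range (Algebra.lsmul k k M'' e)
  let f' : U' →ₗ[k] U := (f.restrictScalars k).restrict fun x hx ↦ by
    rw [mem_range_lsmul_iff he] at hx ⊢
    rw [LinearMap.restrictScalars_apply, ← map_smul, hx]
  let g' : U →ₗ[k] U'' := (g.restrictScalars k).restrict fun x hx ↦ by
    rw [mem_range_lsmul_iff he] at hx ⊢
    rw [LinearMap.restrictScalars_apply, ← map_smul, hx]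
  have hf' : Function.Injective f' := fun x y h ↦
    Subtype.ext (hf (congrArg Subtype.val h))
  have hg' : Function.Surjective g' := by
    rintro ⟨y, hy⟩
    obtain ⟨x, rfl⟩ := hg y
    refine ⟨⟨e • x, x, rfl⟩, Subtype.ext ?_⟩
    change g (e • x) = g x
    rw [map_smul]
    exact (mem_range_lsmul_iff he).1 hy
  have hker : LinearMap.ker g' = LinearMap.range f' := by
    ext ⟨x, hx⟩
    rw [LinearMap.mem_ker, LinearMap.mem_range]
    constructor
    · intro h
      obtain ⟨y, rfl⟩ := (hfg x).1 (congrArg Subtype.val h)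
      refine ⟨⟨y, ?_⟩, rfl⟩
      rw [mem_range_lsmul_iff he] at hx ⊢
      exact hf (by rw [map_smul, hx])
    · rintro ⟨y, hy⟩
      exact Subtype.ext ((hfg x).2 ⟨y, congrArg Subtype.val hy⟩)
  have h := LinearMap.finrank_range_add_finrank_ker g'
  rw [hker, LinearMap.finrank_range_of_inj hf', LinearMap.range_eq_top.2 hg', finrank_top] at h
  change Module.finrank k U = Module.finrank k U' + Module.finrank k U''
  omega

/-- The rank of an idempotent, as an additive function on the Grothendieck group. -/
noncomputable def rankHom {e : B} (he : IsIdempotentElem e) : G0 k B →+ ℤ :=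
  G0.lift (fun M ↦ (rankOn e M : ℤ)) fun _ _ _ f g hf hfg hg ↦ by
    rw [rankOn_eq_add he f g hf hfg hg, Nat.cast_add]

theorem rankHom_of {e : B} (he : IsIdempotentElem e) (M : FinMod k B) :
    rankHom he (G0.of M) = rankOn e M :=
  G0.lift_of _ _ M

theorem rankOn_congr (e : B) {M N : FinMod k B} (φ : M ≃ₗ[B] N) : rankOn e M = rankOn e N := by
  refine LinearEquiv.finrank_eq ((φ.restrictScalars k).ofSubmodules _ _ ?_)
  ext x
  simp only [Submodule.mem_map, LinearMap.mem_range]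
  constructor
  · rintro ⟨_, ⟨y, rfl⟩, rfl⟩
    exact ⟨φ y, (map_smul φ e y).symm⟩
  · rintro ⟨y, rfl⟩
    exact ⟨e • φ.symm y, ⟨_, rfl⟩, by
      change φ (e • φ.symm y) = e • y
      simp⟩

theorem rankOn_one (M : FinMod k B) : rankOn (1 : B) M = Module.finrank k M := by
  rw [rankOn, map_one, Module.End.one_eq_id, LinearMap.range_id, finrank_top]

theorem rankOn_eq_zero {e : B} {M : FinMod k B} (h : ∀ x : M, e • x = 0) : rankOn e M = 0 := by
  have : Algebra.lsmul k k M e = 0 := LinearMap.ext h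
  rw [rankOn, this, LinearMap.range_zero, finrank_bot]

theorem finrank_eq_of_class_eq {M N : FinMod k B} (h : G0.of M = G0.of N) :
    Module.finrank k M = Module.finrank k N := by
  have := congrArg (rankHom (k := k) (B := B) IsIdempotentElem.one) h
  simpa [rankHom_of, rankOn_one] using this

end Field

end DecompositionMap
namespace DecompositionMap

/-! ### The joint representation of a family of modules -/

section RepMap

variable {S B : Type u} [CommRing S] [Ring B] [Algebra S B] {I : Type v}

/-- The joint representation `B → ∏ i, End_S (M i)` of a family of modules. -/
noncomputable def repMap (M : I → FinMod S B) : B →ₗ[S] ∀ i, M i →ₗ[S] M i :=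
  LinearMap.pi fun i ↦ (Algebra.lsmul S S (M i)).toLinearMap

@[simp]
theorem repMap_apply (M : I → FinMod S B) (y : B) (i : I) (x : M i) :
    repMap M y i x = y • x := rfl

/-- A homomorphism between different members of a family with surjective joint representation
vanishes. -/
theorem hom_eq_zero_of_surjective [DecidableEq I] {M : I → FinMod S B}
    (hM : Function.Surjective (repMap M)) {i j : I} (hij : i ≠ j) (f : M i →ₗ[B] M j) : f = 0 := by
  obtain ⟨y, hy⟩ := hM (Pi.single i LinearMap.id)
  ext x
  have h1 : y • x = x := by
    rw [← repMap_apply, hy, Pi.single_eq_same, LinearMap.id_apply]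
  have h2 : y • f x = 0 := by
    rw [← repMap_apply, hy, Pi.single_eq_of_ne hij.symm, LinearMap.zero_apply]
  rw [← h1, map_smul, h2, LinearMap.zero_apply]

theorem eq_of_iso_of_surjective {M : I → FinMod S B}
    (hM : Function.Surjective (repMap M)) (hne : ∀ i, Nontrivial (M i)) {i j : I}
    (e : Nonempty (M i ≃ₗ[B] M j)) : i = j := by
  classical
  obtain ⟨e⟩ := e
  by_contra hij
  obtain ⟨x, hx⟩ := exists_ne (0 : M i)
  have h := LinearMap.congr_fun (hom_eq_zero_of_surjective hM hij e.toLinearMap) x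
  exact hx (e.map_eq_zero_iff.1 h)

theorem exists_smul_eq_of_surjective {M : I → FinMod S B}
    (hM : Function.Surjective (repMap M)) (i : I) (φ : M i →ₗ[S] M i) :
    ∃ y : B, ∀ x : M i, y • x = φ x := by
  classical
  obtain ⟨y, hy⟩ := hM (Pi.single i φ)
  exact ⟨y, fun x ↦ by rw [← repMap_apply, hy, Pi.single_eq_same]⟩

end RepMap

/-! ### Density and dimension counts for split algebras. -/

section RepMapField

variable {k B : Type u} [Field k] [Ring B] [Algebra k B] {I : Type v}

/-- A rank-one map carries any given nonzero vector to any prescribed vector, so each nonzero vector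
generates. -/
theorem isSimple_of_forall_exists_smul {M : FinMod k B} [Nontrivial M]
    (h : ∀ φ : M →ₗ[k] M, ∃ y : B, ∀ x : M, y • x = φ x) : IsSimpleModule B M := by
  refine (isSimpleModule_iff_toSpanSingleton_surjective).2 ⟨inferInstance, fun x hx z ↦ ?_⟩
  obtain ⟨f, hf⟩ := Module.Projective.exists_dual_eq_one k hx
  obtain ⟨y, hy⟩ := h (f.smulRight z)
  exact ⟨y, by simp [hy, hf]⟩

theorem isSimple_of_surjective {M : I → FinMod k B}
    (hM : Function.Surjective (repMap M)) (i : I) [Nontrivial (M i)] : IsSimpleModule B (M i) :=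
  isSimple_of_forall_exists_smul (exists_smul_eq_of_surjective hM i)

/-- If `f x = 1`, then `ψ` commutes with the rank-one map `v ↦ f v • z`; evaluating at `x` gives `ψ
z = f (ψ x) • z`. -/
theorem end_eq_smul_of_forall_exists_smul {M : FinMod k B} [Nontrivial M]
    (h : ∀ φ : M →ₗ[k] M, ∃ y : B, ∀ x : M, y • x = φ x) (ψ : M →ₗ[B] M) :
    ∃ c : k, ∀ x : M, ψ x = c • x := by
  obtain ⟨x, hx⟩ := exists_ne (0 : M)
  obtain ⟨f, hf⟩ := Module.Projective.exists_dual_eq_one k hx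
  refine ⟨f (ψ x), fun z ↦ ?_⟩
  obtain ⟨y, hy⟩ := h (f.smulRight z)
  have h1 : y • x = z := by simp [hy, hf]
  rw [← h1, map_smul, hy, h1, LinearMap.smulRight_apply]

/-- Density: pairwise non-isomorphic simple modules of a split algebra have a surjective joint
representation. -/
theorem repMap_surjective_of_isSplit [Finite I] (hsplit : IsSplit k B) {M : I → FinMod k B}
    (hsimple : ∀ i, IsSimpleModule B (M i))
    (hiso : ∀ i j, Nonempty (M i ≃ₗ[B] M j) → i = j) : Function.Surjective (repMap M) := by
  classical
  have := Fintype.ofFinite I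
  intro g
  -- By Schur's lemma and splitness, an endomorphism of the direct sum is a scalar on each summand.
  -- Every family `g` of linear maps therefore commutes with it, as density requires.
  have hend : ∀ (h : Module.End B (∀ i, M i)) (i : I),
      ∃ c : k, ∀ x : ∀ i, M i, h x i = c • x i := by
    intro h i
    obtain ⟨c, hc⟩ := hsplit (M i) (hsimple i)
      (LinearMap.proj i ∘ₗ h ∘ₗ LinearMap.single B (fun i ↦ M i) i)
    refine ⟨c, fun x ↦ ?_⟩
    have hx : x = ∑ j, LinearMap.single B (fun i ↦ M i) j (x j) :=
      (LinearMap.sum_single_apply (fun i ↦ M i) x).symm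
    conv_lhs => rw [hx, map_sum, Finset.sum_apply]
    rw [Finset.sum_eq_single i, ← hc]
    · rfl
    · intro j _ hji
      have := hsimple i
      have := hsimple j
      let φ : M j →ₗ[B] M i := LinearMap.proj i ∘ₗ h ∘ₗ LinearMap.single B (fun i ↦ M i) j
      rcases φ.bijective_or_eq_zero with hb | h0
      · exact absurd (hiso _ _ ⟨LinearEquiv.ofBijective φ hb⟩) hji
      · exact LinearMap.congr_fun h0 (x j)
    · simp
  let F : Module.End (Module.End B (∀ i, M i)) (∀ i, M i) :=
    { toFun := fun x i ↦ g i (x i)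
      map_add' := fun x y ↦ funext fun i ↦ map_add (g i) _ _
      map_smul' := fun h x ↦ funext fun i ↦ by
        obtain ⟨c, hc⟩ := hend h i
        simp only [Module.End.smul_def, RingHom.id_apply, hc, map_smul] }
  -- Density realizes `F` on finite sets only; a finite set spanning over `k` is enough.
  obtain ⟨s, hs⟩ := Module.Finite.fg_top (R := k) (M := ∀ i, M i)
  obtain ⟨r, hr⟩ := jacobson_density (R := B) F s
  have key : ∀ x : ∀ i, M i, (fun i ↦ g i (x i)) = r • x := by
    intro x
    have hx : x ∈ Submodule.span k (s : Set (∀ i, M i)) := hs ▸ Submodule.mem_top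
    induction hx using Submodule.span_induction with
    | mem x hx => exact hr x hx
    | zero => ext; simp
    | add x y _ _ hx hy => rw [smul_add, ← hx, ← hy]; ext; simp
    | smul c x _ hx =>
      rw [smul_comm, ← hx]
      ext i
      simp
  refine ⟨r, funext fun i ↦ LinearMap.ext fun x ↦ ?_⟩
  have := congrFun (key (Pi.single i x)) i
  simpa using this.symm

theorem finrank_pi_end [Fintype I] (M : I → FinMod k B) :
    Module.finrank k (∀ i, M i →ₗ[k] M i) = ∑ i, Module.finrank k (M i) ^ 2 := by
  rw [Module.finrank_pi_fintype]
  exact Finset.sum_congr rfl fun i _ ↦ by rw [Module.finrank_linearMap, sq]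

theorem sum_sq_of_bijective [Fintype I] {M : I → FinMod k B}
    (hM : Function.Bijective (repMap M)) :
    ∑ i, Module.finrank k (M i) ^ 2 = Module.finrank k B := by
  rw [← finrank_pi_end]
  exact (LinearEquiv.ofBijective _ hM).finrank_eq.symm

variable [Module.Finite k B]

theorem sum_sq_le_of_surjective [Fintype I] {M : I → FinMod k B}
    (hM : Function.Surjective (repMap M)) :
    ∑ i, Module.finrank k (M i) ^ 2 ≤ Module.finrank k B := by
  rw [← finrank_pi_end]
  exact LinearMap.finrank_le_finrank_of_surjective hM

theorem repMap_bijective_of_sum_sq [Fintype I] {M : I → FinMod k B}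
    (hM : Function.Surjective (repMap M))
    (hdim : ∑ i, Module.finrank k (M i) ^ 2 = Module.finrank k B) :
    Function.Bijective (repMap M) :=
  ⟨(LinearMap.injective_iff_surjective_of_finrank_eq_finrank
    (by rw [finrank_pi_end, hdim])).2 hM, hM⟩

/-- A family of simple modules whose squared dimensions add up to the dimension of the algebra
exhausts the simple modules. -/
theorem exists_iso_of_sum_sq [Fintype I] (hsplit : IsSplit k B) {M : I → FinMod k B}
    (hsimple : ∀ i, IsSimpleModule B (M i))
    (hiso : ∀ i j, Nonempty (M i ≃ₗ[B] M j) → i = j)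
    (hdim : ∑ i, Module.finrank k (M i) ^ 2 = Module.finrank k B)
    (T : FinMod k B) (hT : IsSimpleModule B T) : ∃ i, Nonempty (M i ≃ₗ[B] T) := by
  by_contra hcon
  push Not at hcon
  -- Adjoining `T` as one more simple module would exceed the bound on the sum of squares.
  let N : Option I → FinMod k B := fun o ↦ o.elim T M
  have hN : Function.Surjective (repMap N) := by
    refine repMap_surjective_of_isSplit hsplit ?_ ?_
    · rintro (_ | i)
      exacts [hT, hsimple i]
    · rintro (_ | i) (_ | j) ⟨e⟩
      · rfl
      · exact ((hcon j).false e.symm).elim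
      · exact ((hcon i).false e).elim
      · rw [hiso i j ⟨e⟩]
  have h := sum_sq_le_of_surjective hN
  rw [Fintype.sum_option, ← hdim] at h
  have h0 := finrank_pos_of_simple T hT
  have : 0 < Module.finrank k (N none) ^ 2 := pow_pos h0 2
  have h2 : ∑ i, Module.finrank k (N (some i)) ^ 2 = ∑ i, Module.finrank k (M i) ^ 2 := rfl
  omega

/-- The joint representation of all simple modules of a split semisimple algebra is bijective. -/
theorem repMap_bijective_of_isSemisimpleRing [Fintype I] (hsplit : IsSplit k B)
    (hss : IsSemisimpleRing B) {M : I → FinMod k B} (hM : IsSimpleSystem M) :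
    Function.Bijective (repMap M) := by
  refine ⟨?_, repMap_surjective_of_isSplit hsplit hM.simple hM.eq_of_iso⟩
  rw [injective_iff_map_eq_zero]
  intro y hy
  -- An element killing all simple modules kills the class of `1` in `B ⧸ J`, so it lies in every
  -- maximal left ideal `J`.
  have h0 : y ∈ Ring.jacobson B := by
    rw [Ring.jacobson_eq_sInf_isMaximal, Ideal.mem_sInf]
    intro J hJ
    have hs : IsSimpleModule B (B ⧸ J) := isSimpleModule_iff_isCoatom.2 (Ideal.isMaximal_def.1 hJ)
    let T : FinMod k B :=
      { carrier := B ⧸ J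
        finite := Module.Finite.of_surjective (J.mkQ.restrictScalars k) J.mkQ_surjective }
    obtain ⟨i, ⟨e⟩⟩ := hM.exists_iso T hs
    have h1 : y • e.symm (Submodule.Quotient.mk 1 : B ⧸ J) = 0 := by
      rw [← repMap_apply, hy]
      rfl
    rw [← map_smul, e.symm.map_eq_zero_iff] at h1
    change (Submodule.Quotient.mk (y • 1) : B ⧸ J) = 0 at h1
    rwa [smul_eq_mul, mul_one, Submodule.Quotient.mk_eq_zero] at h1
  rwa [IsSemisimpleRing.jacobson_eq_bot] at h0

end RepMapField

end DecompositionMap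
namespace DecompositionMap

/-! ### Modules over `S ⊗ A` and their scalar extensions -/

section Act

variable {R A S : Type u} [CommRing R] [Ring A] [Algebra R A] [CommRing S] [Algebra R S]

/-- The action of `A` on an `A^S`-module by `S`-linear endomorphisms. -/
noncomputable def act (M : FinMod S (S ⊗[R] A)) : A →+* Module.End S M :=
  (Algebra.lsmul S S M).toRingHom.comp
    (Algebra.TensorProduct.includeRight : A →ₐ[R] S ⊗[R] A).toRingHom

theorem act_apply (M : FinMod S (S ⊗[R] A)) (a : A) (x : M) :
    act M a x = ((1 : S) ⊗ₜ[R] a) • x := rfl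

theorem tmul_smul_eq (M : FinMod S (S ⊗[R] A)) (s : S) (a : A) (x : M) :
    (s ⊗ₜ[R] a) • x = s • act M a x := by
  rw [act_apply, ← smul_assoc, TensorProduct.smul_tmul', smul_eq_mul, mul_one]

theorem act_smul (M : FinMod S (S ⊗[R] A)) (r : R) (a : A) :
    act M (r • a) = algebraMap R S r • act M a := by
  ext x
  rw [LinearMap.smul_apply, ← tmul_smul_eq, act_apply, ← TensorProduct.smul_tmul,
    Algebra.algebraMap_eq_smul_one]

theorem map_act {M N : FinMod S (S ⊗[R] A)} (f : M →ₗ[S ⊗[R] A] N) (a : A) (x : M) :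
    f (act M a x) = act N a (f x) := map_smul f _ x

/-- An `S`-linear map commuting with the action of `A` is `A^S`-linear. -/
def homOfAct {M N : FinMod S (S ⊗[R] A)} (f : M →ₗ[S] N)
    (h : ∀ a x, f (act M a x) = act N a (f x)) : M →ₗ[S ⊗[R] A] N where
  toFun := f
  map_add' := map_add f
  map_smul' y x := by
    induction y with
    | zero => simp
    | add y z hy hz => rw [add_smul, map_add, hy, hz, RingHom.id_apply, RingHom.id_apply,
        RingHom.id_apply, add_smul]
    | tmul s a => rw [RingHom.id_apply, tmul_smul_eq, map_smul, h, tmul_smul_eq]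

end Act

section Extension

variable {R A S : Type u} (S' : Type u) [CommRing R] [Ring A] [Algebra R A] [CommRing S]
  [Algebra R S] [CommRing S'] [Algebra R S'] [Algebra S S'] [IsScalarTower R S S']

variable (R A S) in
/-- The canonical homomorphism `A^S → A^{S'}`. -/
noncomputable def extAlg : S ⊗[R] A →ₐ[R] S' ⊗[R] A :=
  Algebra.TensorProduct.map (IsScalarTower.toAlgHom R S S') (AlgHom.id R A)

@[simp]
theorem extAlg_tmul (s : S) (a : A) : extAlg R A S S' (s ⊗ₜ a) = algebraMap S S' s ⊗ₜ a := rfl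

theorem extAlg_smul (s : S) (y : S ⊗[R] A) :
    extAlg R A S S' (s • y) = algebraMap S S' s • extAlg R A S S' y := by
  induction y with
  | zero => simp
  | add y z hy hz => rw [smul_add, map_add, hy, hz, map_add, smul_add]
  | tmul t a => simp only [TensorProduct.smul_tmul', extAlg_tmul, smul_eq_mul, map_mul]

theorem extAlg_injective [Module.Free R A] (h : Function.Injective (algebraMap S S')) :
    Function.Injective (extAlg R A S S') := by
  have h' : Function.Injective (IsScalarTower.toAlgHom R S S').toLinearMap := h
  exact Module.Flat.rTensor_preserves_injective_linearMap (M := A)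
    (IsScalarTower.toAlgHom R S S').toLinearMap h'

namespace FinMod

/-- The canonical map from a module to its scalar extension. -/
noncomputable def incl (M : FinMod S (S ⊗[R] A)) (x : M) : M.baseChange S' := (1 : S') ⊗ₜ[S] x

/-- The scalar extension of an `S`-linear map. -/
noncomputable def map {M N : FinMod S (S ⊗[R] A)} (φ : M →ₗ[S] N) :
    M.baseChange S' →ₗ[S'] N.baseChange S' := LinearMap.baseChange S' φ

variable {S'} {M N : FinMod S (S ⊗[R] A)}

theorem incl_add (x y : M) : M.incl S' (x + y) = M.incl S' x + M.incl S' y :=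
  TensorProduct.tmul_add _ _ _

theorem incl_zero : M.incl S' 0 = 0 :=
  TensorProduct.tmul_zero _ _

theorem incl_smul (s : S) (x : M) : M.incl S' (s • x) = algebraMap S S' s • M.incl S' x := by
  change (1 : S') ⊗ₜ[S] (s • x) = algebraMap S S' s • ((1 : S') ⊗ₜ[S] x)
  rw [← TensorProduct.smul_tmul, TensorProduct.smul_tmul', Algebra.algebraMap_eq_smul_one,
    smul_eq_mul, mul_one]

theorem incl_sum {ι : Type*} (s : Finset ι) (x : ι → M) :
    M.incl S' (∑ i ∈ s, x i) = ∑ i ∈ s, M.incl S' (x i) :=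
  TensorProduct.tmul_sum _ _ _

theorem map_incl (φ : M →ₗ[S] N) (x : M) : map S' φ (M.incl S' x) = N.incl S' (φ x) :=
  LinearMap.baseChange_tmul _ _ _

theorem induction_incl {P : M.baseChange S' → Prop} (hincl : ∀ x, P (M.incl S' x))
    (hadd : ∀ x y, P x → P y → P (x + y)) (hsmul : ∀ (s : S') x, P x → P (s • x)) (z) : P z := by
  induction z using TensorProduct.induction_on with
  | zero => exact incl_zero (M := M) (S' := S') ▸ hincl 0
  | add x y hx hy => exact hadd x y hx hy
  | tmul s x =>
    have h := hsmul s _ (hincl x)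
    have h2 : s • M.incl S' x = (s ⊗ₜ[S] x : S' ⊗[S] M) := by
      change s • ((1 : S') ⊗ₜ[S] x) = s ⊗ₜ[S] x
      rw [TensorProduct.smul_tmul', smul_eq_mul, mul_one]
    rwa [h2] at h

theorem hom_ext_incl {P : Type*} [AddCommGroup P] [Module S' P] {f g : M.baseChange S' →ₗ[S'] P}
    (h : ∀ x, f (M.incl S' x) = g (M.incl S' x)) : f = g := by
  ext z
  induction z using induction_incl with
  | hincl x => exact h x
  | hadd x y hx hy => rw [_root_.map_add, _root_.map_add, hx, hy]
  | hsmul s x hx => rw [_root_.map_smul, _root_.map_smul, hx]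

theorem smul_incl_one (a : A) (x : M) :
    ((1 : S') ⊗ₜ[R] a) • M.incl S' x = M.incl S' (act M a x) := by
  change extAction S' M ((1 : S') ⊗ₜ[R] a) ((1 : S') ⊗ₜ[S] x) = _
  rw [extAction_tmul, one_mul]
  rfl

theorem act_incl (a : A) (x : M) :
    act (M.baseChange S') a (M.incl S' x) = M.incl S' (act M a x) := smul_incl_one a x

theorem extAlg_smul_incl (y : S ⊗[R] A) (x : M) :
    extAlg R A S S' y • M.incl S' x = M.incl S' (y • x) := by
  induction y with
  | zero => rw [_root_.map_zero, zero_smul, zero_smul, incl_zero]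
  | add y z hy hz => rw [_root_.map_add, add_smul, hy, hz, ← incl_add, add_smul]
  | tmul s a => rw [extAlg_tmul, tmul_smul_eq, act_incl, tmul_smul_eq, incl_smul]

theorem incl_injective [Module.Free S M] (h : Function.Injective (algebraMap S S')) :
    Function.Injective (M.incl S') := by
  have h' := Module.Flat.rTensor_preserves_injective_linearMap (M := M)
    (Algebra.linearMap S S') h
  intro x y hxy
  have : (Algebra.linearMap S S').rTensor M ((1 : S) ⊗ₜ x) =
      (Algebra.linearMap S S').rTensor M ((1 : S) ⊗ₜ y) := by
    simp only [LinearMap.rTensor_tmul, Algebra.linearMap_apply, map_one]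
    exact hxy
  simpa using congrArg (TensorProduct.lid S M) (h' this)

/-- The basis of the scalar extension induced by a basis. -/
noncomputable def basis {ι : Type*} (w : Module.Basis ι S M) :
    Module.Basis ι S' (M.baseChange S') := w.baseChange S'

theorem basis_apply {ι : Type*} (w : Module.Basis ι S M) (i : ι) :
    basis (S' := S') w i = M.incl S' (w i) := Module.Basis.baseChange_apply S' w i

theorem finrank_baseChange [StrongRankCondition S] [StrongRankCondition S'] [Module.Free S M] :
    Module.finrank S' (M.baseChange S') = Module.finrank S M :=
  Module.finrank_baseChange

/-- The matrix units of a basis of `M` extend to the matrix units of the induced basis. -/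
theorem mem_span_range_map [Module.Free S M]
    (ψ : M.baseChange S' →ₗ[S'] M.baseChange S') :
    ψ ∈ Submodule.span S' (Set.range (map (M := M) (N := M) S')) := by
  classical
  let w := Module.Free.chooseBasis S M
  have key : ψ = ∑ s, ∑ t, (basis (S' := S') w).repr (ψ (M.incl S' (w s))) t •
      map S' ((w.coord s).smulRight (w t)) := by
    refine (basis (S' := S') w).ext fun r ↦ ?_
    rw [basis_apply]
    simp only [LinearMap.sum_apply, LinearMap.smul_apply, map_incl, LinearMap.smulRight_apply,
      Module.Basis.coord_apply, Module.Basis.repr_self, Finsupp.single_apply]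
    rw [Finset.sum_eq_single r]
    · simp only [if_true, one_smul]
      conv_lhs => rw [← (basis (S' := S') w).sum_repr (ψ (M.incl S' (w r)))]
      simp only [basis_apply]
    · intro s _ hs
      simp [Ne.symm hs, incl_zero]
    · simp
  rw [key]
  exact Submodule.sum_mem _ fun s _ ↦ Submodule.sum_mem _ fun t _ ↦
    Submodule.smul_mem _ _ (Submodule.subset_span ⟨_, rfl⟩)

/-- The scalar extension of an isomorphism. -/
noncomputable def congr (e : M ≃ₗ[S ⊗[R] A] N) :
    M.baseChange S' ≃ₗ[S' ⊗[R] A] N.baseChange S' :=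
  LinearEquiv.ofLinearMap (baseChangeMap S' e.toLinearMap) (baseChangeMap S' e.symm.toLinearMap)
    (by
      have h : map S' (e.toLinearMap.restrictScalars S) ∘ₗ
          map S' (e.symm.toLinearMap.restrictScalars S) = LinearMap.id :=
        hom_ext_incl fun x ↦ by simp [map_incl]
      exact LinearMap.ext fun x ↦ LinearMap.congr_fun h x)
    (by
      have h : map S' (e.symm.toLinearMap.restrictScalars S) ∘ₗ
          map S' (e.toLinearMap.restrictScalars S) = LinearMap.id :=
        hom_ext_incl fun x ↦ by simp [map_incl]
      exact LinearMap.ext fun x ↦ LinearMap.congr_fun h x)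

end FinMod

open FinMod in
/-- Surjectivity of the joint representation is stable under scalar extension. -/
theorem repMap_baseChange_surjective {I : Type v} [Finite I] {M : I → FinMod S (S ⊗[R] A)}
    [∀ i, Module.Free S (M i)] (hM : Function.Surjective (repMap M)) :
    Function.Surjective (repMap fun i ↦ (M i).baseChange S') := by
  classical
  have := Fintype.ofFinite I
  rw [← LinearMap.range_eq_top, eq_top_iff]
  rintro g -
  rw [← LinearMap.sum_single_apply
    (fun i ↦ (M i).baseChange S' →ₗ[S'] (M i).baseChange S') g]
  refine Submodule.sum_mem _ fun i _ ↦ ?_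
  suffices h : Submodule.span S' (Set.range (FinMod.map (M := M i) (N := M i) S')) ≤
      (LinearMap.range (repMap fun i ↦ (M i).baseChange S')).comap
        (LinearMap.single S' (fun i ↦ (M i).baseChange S' →ₗ[S'] (M i).baseChange S') i) from
    h (FinMod.mem_span_range_map (g i))
  rw [Submodule.span_le]
  rintro _ ⟨φ, rfl⟩
  obtain ⟨y, hy⟩ := hM (Pi.single i φ)
  refine ⟨extAlg R A S S' y, funext fun j ↦ FinMod.hom_ext_incl fun x ↦ ?_⟩
  rw [repMap_apply, FinMod.extAlg_smul_incl, ← repMap_apply, hy]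
  rcases eq_or_ne j i with rfl | hji
  · simp [FinMod.map_incl]
  · simp [hji, FinMod.incl_zero]

end Extension

/-! ### Field extensions of split algebras. -/

section FieldExtension

variable {R A k : Type u} (L : Type u) [CommRing R] [Ring A] [Algebra R A] [Field k]
  [Algebra R k] [Field L] [Algebra R L] [Algebra k L] [IsScalarTower R k L]

theorem end_baseChange_of_isSplit (hsplit : IsSplit k (k ⊗[R] A)) (T : FinMod k (k ⊗[R] A))
    (hT : IsSimpleModule (k ⊗[R] A) T) (φ : T.baseChange L →ₗ[L] T.baseChange L) :
    ∃ y : L ⊗[R] A, ∀ x : T.baseChange L, y • x = φ x := by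
  have h := repMap_surjective_of_isSplit (I := Unit) (M := fun _ ↦ T) hsplit (fun _ ↦ hT)
    fun _ _ _ ↦ rfl
  exact exists_smul_eq_of_surjective (repMap_baseChange_surjective L h) () φ

theorem nontrivial_baseChange (T : FinMod k (k ⊗[R] A)) [Nontrivial T] :
    Nontrivial (T.baseChange L) :=
  (FinMod.incl_injective (S' := L) (M := T) (algebraMap k L).injective).nontrivial

/-- Simple modules of split algebras are absolutely simple. -/
theorem isSimple_baseChange (hsplit : IsSplit k (k ⊗[R] A)) (T : FinMod k (k ⊗[R] A))
    (hT : IsSimpleModule (k ⊗[R] A) T) : IsSimpleModule (L ⊗[R] A) (T.baseChange L) := by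
  have := hT.nontrivial
  have := nontrivial_baseChange L T
  exact isSimple_of_forall_exists_smul (end_baseChange_of_isSplit L hsplit T hT)

/-- Every simple module over a scalar extension of a split algebra is a scalar extension. -/
theorem exists_iso_baseChange [Module.Finite R A] (hsplit : IsSplit k (k ⊗[R] A)) (X : FinMod L (L ⊗[R] A))
    (hX : IsSimpleModule (L ⊗[R] A) X) :
    ∃ T : FinMod k (k ⊗[R] A), IsSimpleModule (k ⊗[R] A) T ∧
      Nonempty (T.baseChange L ≃ₗ[L ⊗[R] A] X) := by
  have := hX.nontrivial
  obtain ⟨x, hx⟩ := exists_ne (0 : X)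
  let σ : k ⊗[R] A →+* L ⊗[R] A := (extAlg R A k L).toRingHom
  -- The `A^k`-submodule of `X` generated by one nonzero vector is finite-dimensional over `k`,
  -- although `X` need not be. A simple submodule `T` of it is the required form.
  let f : k ⊗[R] A →ₛₗ[σ] X :=
    { toFun := fun y ↦ σ y • x
      map_add' := fun y z ↦ by rw [map_add, add_smul]
      map_smul' := fun y z ↦ by rw [smul_eq_mul, map_mul, mul_smul] }
  let P : FinMod k (k ⊗[R] A) :=
    { carrier := (k ⊗[R] A) ⧸ LinearMap.ker f
      finite := Module.Finite.of_surjective ((LinearMap.ker f).mkQ.restrictScalars k)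
        (LinearMap.ker f).mkQ_surjective }
  let g : P →ₛₗ[σ] X := (LinearMap.ker f).liftQ f le_rfl
  have hg : Function.Injective g := by
    rw [← LinearMap.ker_eq_bot]
    exact Submodule.ker_liftQ_eq_bot _ _ _ le_rfl
  have : Nontrivial P := by
    refine ⟨(Submodule.Quotient.mk 1 : (k ⊗[R] A) ⧸ LinearMap.ker f), 0, fun h ↦ hx ?_⟩
    rw [Submodule.Quotient.mk_eq_zero, LinearMap.mem_ker] at h
    simpa [f] using h
  obtain ⟨N, hN⟩ := P.exists_simple_submodule
  let T : FinMod k (k ⊗[R] A) := P.sub N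
  have hT : IsSimpleModule (k ⊗[R] A) T := hN
  refine ⟨T, hT, ?_⟩
  let _ : Module k X := Module.compHom X (algebraMap k L)
  have : IsScalarTower k L X := IsScalarTower.of_algebraMap_smul fun _ _ ↦ rfl
  have hsm : ∀ (y : k ⊗[R] A) (z : P), g (y • z) = σ y • g z := fun y z ↦ g.map_smulₛₗ y z
  let h : T →ₗ[k] X :=
    { toFun := fun t ↦ g (P.subIncl N t)
      map_add' := fun s t ↦ by rw [map_add, map_add]
      map_smul' := fun c t ↦ by
        have h1 : P.subIncl N (c • t) = algebraMap k (k ⊗[R] A) c • P.subIncl N t := by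
          rw [algebraMap_smul]
          rfl
        have h2 : σ (algebraMap k (k ⊗[R] A) c) = algebraMap L (L ⊗[R] A) (algebraMap k L c) :=
          rfl
        rw [h1, hsm, h2, algebraMap_smul]
        rfl }
  let φ : T.baseChange L →ₗ[L] X := h.liftBaseChange L
  have hφ : ∀ t, φ (T.incl L t) = g (P.subIncl N t) := fun t ↦ by
    change h.liftBaseChange L ((1 : L) ⊗ₜ t) = _
    rw [LinearMap.liftBaseChange_tmul, one_smul]
    rfl
  -- The inclusion of `T` extends to a nonzero map between simple modules, hence an isomorphism.
  let Φ : T.baseChange L →ₗ[L ⊗[R] A] X := homOfAct φ fun a z ↦ by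
    induction z using FinMod.induction_incl with
    | hincl t =>
      rw [FinMod.act_incl, hφ, hφ, act_apply, act_apply, map_smul, hsm]
      congr 1
      change extAlg R A k L (1 ⊗ₜ a) = _
      rw [extAlg_tmul, map_one]
    | hadd x y hx hy => rw [map_add, map_add, hx, hy, map_add, map_add]
    | hsmul s x hx => rw [map_smul, map_smul, hx, map_smul, map_smul]
  have := isSimple_baseChange L hsplit T hT
  rcases Φ.bijective_or_eq_zero with hb | h0
  · exact ⟨LinearEquiv.ofBijective Φ hb⟩
  · exfalso
    have := hT.nontrivial
    obtain ⟨t, ht⟩ := exists_ne (0 : T)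
    have h1 : φ (T.incl L t) = 0 := LinearMap.congr_fun h0 (T.incl L t)
    rw [hφ] at h1
    exact ht (P.subIncl_injective N (by rw [map_zero]; exact hg (by rw [h1, map_zero])))

theorem IsSplit.baseChange [Module.Finite R A] (hsplit : IsSplit k (k ⊗[R] A)) : IsSplit L (L ⊗[R] A) := by
  intro X hX φ
  obtain ⟨T, hT, ⟨e⟩⟩ := exists_iso_baseChange L hsplit X hX
  have := hT.nontrivial
  have := nontrivial_baseChange L T
  obtain ⟨c, hc⟩ := end_eq_smul_of_forall_exists_smul (end_baseChange_of_isSplit L hsplit T hT)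
    (e.symm.toLinearMap ∘ₗ φ ∘ₗ e.toLinearMap)
  refine ⟨c, fun x ↦ ?_⟩
  have h := congrArg e (hc (e.symm x))
  have h2 : e (c • e.symm x) = c • x := by
    rw [← algebraMap_smul (L ⊗[R] A) c, map_smul, e.apply_symm_apply, algebraMap_smul]
  simpa [h2] using h

theorem G0.ext_of (T : FinMod k (k ⊗[R] A)) :
    G0.ext L (G0.of T) = G0.of (T.baseChange L) := by
  change FreeAbelianGroup.lift (fun M ↦ G0.of (FinMod.baseChange L M)) (FreeAbelianGroup.of T) = _
  simp

/-- Scalar extension is surjective on Grothendieck groups of split algebras. -/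
theorem G0.ext_surjective [Module.Finite R A] (hsplit : IsSplit k (k ⊗[R] A)) (M : FinMod L (L ⊗[R] A)) :
    G0.of M ∈ (G0.ext L : G0 k (k ⊗[R] A) →+ G0 L (L ⊗[R] A)).range := by
  refine G0.of_mem_closure _ ?_ M
  rintro _ ⟨X, hX, rfl⟩
  obtain ⟨T, hT, ⟨e⟩⟩ := exists_iso_baseChange L hsplit X hX
  exact ⟨G0.of T, by rw [G0.ext_of, G0.of_congr e]⟩

end FieldExtension

end DecompositionMap
namespace DecompositionMap

/-! ### Dual bases -/

section DualBases

variable {S B ι κ : Type*} [CommRing S] [Ring B] [Algebra S B] [Fintype ι] [Fintype κ]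
  [DecidableEq ι] [DecidableEq κ] {t : B →ₗ[S] S} {b b' : Module.Basis ι S B}
  {c c' : Module.Basis κ S B}

theorem sum_dual_smul (h : ∀ i j, t (b' i * b j) = if i = j then 1 else 0) (x : B) :
    ∑ i, t (b' i * x) • b i = x := by
  have key : ∀ i, t (b' i * x) = b.repr x i := fun i ↦ by
    conv_lhs => rw [← b.sum_repr x, Finset.mul_sum, map_sum]
    simp [h]
  simp_rw [key]
  exact b.sum_repr x

theorem sum_smul_dual (h : ∀ i j, t (b' i * b j) = if i = j then 1 else 0) (x : B) :
    ∑ i, t (x * b i) • b' i = x := by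
  have key : ∀ i, t (x * b i) = b'.repr x i := fun i ↦ by
    conv_lhs => rw [← b'.sum_repr x, Finset.sum_mul, map_sum]
    simp [h]
  simp_rw [key]
  exact b'.sum_repr x

/-- The Casimir tensor does not depend on the choice of the dual bases. -/
theorem casimirTensor_eq (h : ∀ i j, t (b' i * b j) = if i = j then 1 else 0)
    (h' : ∀ i j, t (c' i * c j) = if i = j then 1 else 0) :
    ∑ i, b i ⊗ₜ[S] b' i = ∑ k, c k ⊗ₜ[S] c' k := by
  calc ∑ i, b i ⊗ₜ[S] b' i = ∑ i, ∑ k, (t (c' k * b i) • c k) ⊗ₜ[S] b' i := by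
        refine Finset.sum_congr rfl fun i _ ↦ ?_
        rw [← TensorProduct.sum_tmul, sum_dual_smul h']
    _ = ∑ k, ∑ i, c k ⊗ₜ[S] (t (c' k * b i) • b' i) := by
        rw [Finset.sum_comm]
        simp only [TensorProduct.smul_tmul]
    _ = _ := by
        refine Finset.sum_congr rfl fun k _ ↦ ?_
        rw [← TensorProduct.tmul_sum, sum_smul_dual h]

/-- Expand `a * b i` in the basis `b`, move the coefficients across the tensor sign, and recollect
them with the dual expansion. This is what makes Casimir operators `A`-linear. -/
theorem casimirTensor_mul_left (h : ∀ i j, t (b' i * b j) = if i = j then 1 else 0) (a : B) :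
    ∑ i, (a * b i) ⊗ₜ[S] b' i = ∑ i, b i ⊗ₜ[S] (b' i * a) := by
  calc ∑ i, (a * b i) ⊗ₜ[S] b' i = ∑ i, ∑ k, (t (b' k * (a * b i)) • b k) ⊗ₜ[S] b' i := by
        refine Finset.sum_congr rfl fun i _ ↦ ?_
        rw [← TensorProduct.sum_tmul, sum_dual_smul h]
    _ = ∑ k, ∑ i, b k ⊗ₜ[S] (t (b' k * a * b i) • b' i) := by
        rw [Finset.sum_comm]
        simp only [TensorProduct.smul_tmul, mul_assoc]
    _ = _ := by
        refine Finset.sum_congr rfl fun k _ ↦ ?_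
        rw [← TensorProduct.tmul_sum, sum_smul_dual h]

/-- The same expansion, with the symmetry of `t` carrying `a` around the product. It makes the
Casimir operator insensitive to cyclic permutation, like a trace. -/
theorem casimirTensor_mul_right (h : ∀ i j, t (b' i * b j) = if i = j then 1 else 0)
    (ht : ∀ x y, t (x * y) = t (y * x)) (a : B) :
    ∑ i, (b i * a) ⊗ₜ[S] b' i = ∑ i, b i ⊗ₜ[S] (a * b' i) := by
  calc ∑ i, (b i * a) ⊗ₜ[S] b' i = ∑ i, ∑ k, (t (b' k * (b i * a)) • b k) ⊗ₜ[S] b' i := by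
        refine Finset.sum_congr rfl fun i _ ↦ ?_
        rw [← TensorProduct.sum_tmul, sum_dual_smul h]
    _ = ∑ k, ∑ i, b k ⊗ₜ[S] (t (a * b' k * b i) • b' i) := by
        rw [Finset.sum_comm]
        have : ∀ i k, t (b' k * (b i * a)) = t (a * b' k * b i) := fun i k ↦ by
          rw [← mul_assoc, ht, mul_assoc]
        simp only [TensorProduct.smul_tmul, this]
    _ = _ := by
        refine Finset.sum_congr rfl fun k _ ↦ ?_
        rw [← TensorProduct.tmul_sum, sum_smul_dual h]

end DualBases

/-! ### Casimir operators -/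

section Casimir

variable {R A S ι : Type u} [CommRing R] [Ring A] [Algebra R A] [CommRing S] [Algebra R S]
  [Fintype ι]

/-- The Casimir operator `φ ↦ ∑ j, b j ∘ φ ∘ b' j`. -/
noncomputable def casimir (b b' : ι → A) (M N : FinMod S (S ⊗[R] A)) :
    (M →ₗ[S] N) →ₗ[S] (M →ₗ[S] N) where
  toFun φ := ∑ j, act N (b j) ∘ₗ φ ∘ₗ act M (b' j)
  map_add' φ ψ := by
    simp only [LinearMap.add_comp, LinearMap.comp_add, Finset.sum_add_distrib]
  map_smul' s φ := by
    simp only [LinearMap.smul_comp, LinearMap.comp_smul, Finset.smul_sum, RingHom.id_apply]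

variable {b b' : ι → A} {M N P : FinMod S (S ⊗[R] A)}

theorem casimir_apply (φ : M →ₗ[S] N) (x : M) :
    casimir b b' M N φ x = ∑ j, act N (b j) (φ (act M (b' j) x)) := by
  simp [casimir]

theorem comp_casimir (g : N →ₗ[S ⊗[R] A] P) (φ : M →ₗ[S] N) :
    g.restrictScalars S ∘ₗ casimir b b' M N φ = casimir b b' M P (g.restrictScalars S ∘ₗ φ) := by
  ext x
  simp [casimir_apply, map_act]

theorem casimir_comp (f : P →ₗ[S ⊗[R] A] M) (φ : M →ₗ[S] N) :
    casimir b b' M N φ ∘ₗ f.restrictScalars S = casimir b b' P N (φ ∘ₗ f.restrictScalars S) := by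
  ext x
  simp [casimir_apply, map_act]

/-- Evaluation of a tensor of algebra elements at a linear map between modules. -/
noncomputable def tensorEval (φ : M →ₗ[S] N) : A ⊗[R] A →+ (M →ₗ[S] N) :=
  TensorProduct.liftAddHom
    { toFun := fun a ↦
        { toFun := fun a' ↦ act N a ∘ₗ φ ∘ₗ act M a'
          map_zero' := by rw [map_zero]; ext; simp
          map_add' := fun x y ↦ by rw [map_add, LinearMap.comp_add, LinearMap.comp_add] }
      map_zero' := by
        ext : 2
        simp
      map_add' := fun x y ↦ by
        ext : 2
        simp [LinearMap.add_comp] }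
    (fun r a a' ↦ by
      simp [act_smul, LinearMap.smul_comp, LinearMap.comp_smul])

theorem tensorEval_tmul (φ : M →ₗ[S] N) (a a' : A) :
    tensorEval φ (a ⊗ₜ[R] a') = act N a ∘ₗ φ ∘ₗ act M a' := rfl

end Casimir

section DualCasimir

variable {R A S ι : Type u} [CommRing R] [Ring A] [Algebra R A] [CommRing S] [Algebra R S]
  [Fintype ι] [DecidableEq ι] {τ : A →ₗ[R] R} {b b' : Module.Basis ι R A}
  {M N P : FinMod S (S ⊗[R] A)}

theorem casimir_act (h : ∀ i j, τ (b' i * b j) = if i = j then 1 else 0) (φ : M →ₗ[S] N)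
    (a : A) (x : M) :
    casimir b b' M N φ (act M a x) = act N a (casimir b b' M N φ x) := by
  have h1 := congrArg (fun z ↦ tensorEval φ z x) (casimirTensor_mul_left h a)
  simp only [map_sum, tensorEval_tmul, LinearMap.sum_apply, LinearMap.comp_apply, map_mul,
    Module.End.mul_apply] at h1
  rw [casimir_apply, casimir_apply, map_sum]
  exact h1.symm

/-- The Casimir operator takes values in `A^S`-linear maps. -/
noncomputable def casimirHom (h : ∀ i j, τ (b' i * b j) = if i = j then 1 else 0)
    (φ : M →ₗ[S] N) : M →ₗ[S ⊗[R] A] N :=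
  homOfAct (casimir b b' M N φ) (casimir_act h φ)

theorem casimirHom_apply (h : ∀ i j, τ (b' i * b j) = if i = j then 1 else 0)
    (φ : M →ₗ[S] N) (x : M) : casimirHom h φ x = casimir b b' M N φ x := rfl

theorem casimir_comp_act (h : ∀ i j, τ (b' i * b j) = if i = j then 1 else 0)
    (hτ : ∀ x y, τ (x * y) = τ (y * x)) (φ : M →ₗ[S] N) (a : A) :
    casimir b b' M N (φ ∘ₗ act M a) = casimir b b' M N (act N a ∘ₗ φ) := by
  have h1 := congrArg (fun z ↦ tensorEval φ z) (casimirTensor_mul_right h hτ a)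
  ext x
  have h2 := LinearMap.congr_fun h1 x
  simp only [map_sum, tensorEval_tmul, LinearMap.sum_apply, LinearMap.comp_apply, map_mul,
    Module.End.mul_apply] at h2
  rw [casimir_apply, casimir_apply]
  exact h2.symm

/-- When the algebra surjects onto `End(M)`, this says that the Casimir operator takes the same
value on `φ ∘ ψ` and `ψ ∘ φ`, so it factors through the trace. -/
theorem casimir_comp_lsmul (h : ∀ i j, τ (b' i * b j) = if i = j then 1 else 0)
    (hτ : ∀ x y, τ (x * y) = τ (y * x)) (φ : M →ₗ[S] N) (y : S ⊗[R] A) :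
    casimir b b' M N (φ ∘ₗ Algebra.lsmul S S M y) =
      casimir b b' M N (Algebra.lsmul S S N y ∘ₗ φ) := by
  induction y with
  | zero => simp
  | add y z hy hz =>
    rw [map_add, map_add, LinearMap.comp_add, LinearMap.add_comp, map_add, map_add, hy, hz]
  | tmul s a =>
    have h1 : ∀ Q : FinMod S (S ⊗[R] A), Algebra.lsmul S S Q (s ⊗ₜ[R] a) = s • act Q a :=
      fun Q ↦ LinearMap.ext fun x ↦ tmul_smul_eq Q s a x
    rw [h1, h1, LinearMap.comp_smul, LinearMap.smul_comp, map_smul, map_smul,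
      casimir_comp_act h hτ]

end DualCasimir

/-! ### Schur elements -/

section SchurConst

variable {R A S ι : Type u} [CommRing R] [Ring A] [Algebra R A] [CommRing S] [Algebra R S]
  [Fintype ι]

/-- The Casimir operator on `End_S(M)` is given by `φ ↦ c Tr(φ)`. -/
def HasSchurConst (b b' : ι → A) (M : FinMod S (S ⊗[R] A)) (c : S) : Prop :=
  ∀ φ : M →ₗ[S] M, casimir b b' M M φ = (c * LinearMap.trace S M φ) • LinearMap.id

variable {b b' : ι → A} {M N : FinMod S (S ⊗[R] A)}

theorem HasSchurConst.congr {c : S} (hM : HasSchurConst b b' M c) (e : M ≃ₗ[S ⊗[R] A] N) :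
    HasSchurConst b b' N c := by
  intro φ
  let e' : M ≃ₗ[S] N := e.restrictScalars S
  have h := hM (e'.symm.conj φ)
  rw [LinearMap.trace_conj'] at h
  have h2 : φ = e.toLinearMap.restrictScalars S ∘ₗ (e'.symm.conj φ) ∘ₗ
      e.symm.toLinearMap.restrictScalars S := by
    ext x
    simp [LinearEquiv.conj_apply, e']
  conv_lhs => rw [h2]
  rw [← comp_casimir, ← casimir_comp, h]
  ext x
  change e' ((c * LinearMap.trace S N φ) • e'.symm x) = (c * LinearMap.trace S N φ) • x
  rw [map_smul, e'.apply_symm_apply]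

theorem casimir_eq_zero_congr {M' N' : FinMod S (S ⊗[R] A)} (e : M ≃ₗ[S ⊗[R] A] M')
    (e' : N ≃ₗ[S ⊗[R] A] N') (h : casimir b b' M N = 0) : casimir b b' M' N' = 0 := by
  ext1 φ
  have h2 : φ = e'.toLinearMap.restrictScalars S ∘ₗ
      (e'.symm.toLinearMap.restrictScalars S ∘ₗ φ ∘ₗ e.toLinearMap.restrictScalars S) ∘ₗ
      e.symm.toLinearMap.restrictScalars S := by
    ext x
    simp
  rw [h2, ← comp_casimir, ← casimir_comp, h]
  simp

variable {S' : Type u} [CommRing S'] [Algebra R S'] [Algebra S S'] [IsScalarTower R S S']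

open FinMod

theorem casimir_map (φ : M →ₗ[S] N) :
    casimir b b' (M.baseChange S') (N.baseChange S') (FinMod.map S' φ) =
      FinMod.map S' (casimir b b' M N φ) := by
  refine hom_ext_incl fun x ↦ ?_
  rw [casimir_apply, map_incl, casimir_apply, incl_sum]
  simp only [act_incl, map_incl]

theorem trace_map [Module.Free S M] (φ : M →ₗ[S] M) :
    LinearMap.trace S' (M.baseChange S') (FinMod.map S' φ) =
      algebraMap S S' (LinearMap.trace S M φ) :=
  LinearMap.trace_baseChange φ S'

theorem HasSchurConst.baseChange [Module.Free S M] {c : S} (h : HasSchurConst b b' M c) :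
    HasSchurConst b b' (M.baseChange S') (algebraMap S S' c) := by
  intro ψ
  induction mem_span_range_map ψ using Submodule.span_induction with
  | mem ψ hψ =>
    obtain ⟨φ, rfl⟩ := hψ
    rw [casimir_map, h, trace_map, ← map_mul]
    refine hom_ext_incl fun x ↦ ?_
    rw [map_incl, LinearMap.smul_apply, LinearMap.smul_apply, LinearMap.id_apply,
      LinearMap.id_apply, incl_smul]
  | zero => simp
  | add ψ ψ' _ _ h1 h2 => rw [_root_.map_add, h1, h2, ← add_smul, ← mul_add, _root_.map_add]
  | smul s ψ _ h1 =>
    rw [_root_.map_smul, h1, _root_.map_smul, smul_smul, smul_eq_mul, mul_left_comm]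

theorem HasSchurConst.of_baseChange [Module.Free S M]
    (hinj : Function.Injective (algebraMap S S')) {c : S}
    (h : HasSchurConst b b' (M.baseChange S') (algebraMap S S' c)) : HasSchurConst b b' M c := by
  intro φ
  ext x
  have h1 := LinearMap.congr_fun (h (FinMod.map S' φ)) (M.incl S' x)
  rw [casimir_map, trace_map, ← map_mul, map_incl, LinearMap.smul_apply, LinearMap.id_apply,
    ← incl_smul] at h1
  exact incl_injective hinj h1

theorem casimir_eq_zero_of_baseChange [Module.Free S N]
    (hinj : Function.Injective (algebraMap S S'))
    (h : casimir b b' (M.baseChange S') (N.baseChange S') = 0) : casimir b b' M N = 0 := by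
  ext φ x
  have h1 := LinearMap.congr_fun (LinearMap.congr_fun h (FinMod.map S' φ)) (M.incl S' x)
  rw [casimir_map, map_incl] at h1
  exact incl_injective hinj (h1.trans incl_zero.symm)

theorem end_eq_sum_smulRight {κ V W : Type*} [Fintype κ] [AddCommGroup V] [Module S V]
    [AddCommGroup W] [Module S W] (w : Module.Basis κ S V) (φ : V →ₗ[S] W) :
    φ = ∑ i, (w.coord i).smulRight (φ (w i)) := by
  classical
  refine w.ext fun j ↦ ?_
  simp [LinearMap.sum_apply, Finsupp.single_apply]

/-- The element of the algebra attached to a matrix coefficient. -/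
noncomputable def coeffElt (b b' : ι → A) (M : FinMod S (S ⊗[R] A)) (f : M →ₗ[S] S) (x : M) :
    S ⊗[R] A := ∑ j, f (act M (b' j) x) ⊗ₜ[R] b j

/-- One algebra element acts on every module `N` through a Casimir operator from `M` to `N`, so the
Schur relations determine its action on all simple modules simultaneously. -/
theorem coeffElt_smul (f : M →ₗ[S] S) (x : M) (z : N) :
    coeffElt b b' M f x • z = casimir b b' M N (f.smulRight z) x := by
  rw [coeffElt, Finset.sum_smul, casimir_apply]
  exact Finset.sum_congr rfl fun j _ ↦ by rw [tmul_smul_eq, LinearMap.smulRight_apply, map_smul]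

/-- If the Schur elements are invertible, the joint representation is surjective. -/
theorem repMap_surjective_of_isUnit {I : Type v} [Finite I] {W : I → FinMod S (S ⊗[R] A)}
    [∀ i, Module.Free S (W i)] {c : I → S} (hc : ∀ i, IsUnit (c i))
    (hW : ∀ i, HasSchurConst b b' (W i) (c i))
    (hij : ∀ i j, i ≠ j → casimir b b' (W i) (W j) = 0) : Function.Surjective (repMap W) := by
  classical
  have := Fintype.ofFinite I
  rw [← LinearMap.range_eq_top, eq_top_iff]
  rintro g -
  rw [← LinearMap.sum_single_apply (fun i ↦ W i →ₗ[S] W i) g]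
  refine Submodule.sum_mem _ fun i _ ↦ ?_
  let w := Module.Free.chooseBasis S (W i)
  rw [end_eq_sum_smulRight w (g i),
    ← LinearMap.single_apply (R := S) (φ := fun i ↦ W i →ₗ[S] W i), map_sum]
  refine Submodule.sum_mem _ fun s _ ↦ ?_
  obtain ⟨d, hd⟩ := (hc i).exists_left_inv
  -- The Casimir element acts on `W i` as `c i` times the rank-one map `z ↦ w.coord s z • g i (w s)`
  -- and as zero on the other members; `d` is the inverse of `c i`.
  refine ⟨d • coeffElt b b' (W i) (w.coord s) (g i (w s)), funext fun j ↦ LinearMap.ext fun z ↦ ?_⟩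
  rw [repMap_apply, smul_assoc, coeffElt_smul]
  rcases eq_or_ne j i with rfl | hji
  · rw [hW, LinearMap.trace_smulRight, LinearMap.smul_apply, LinearMap.id_apply, smul_smul,
      ← mul_assoc, hd, one_mul]
    simp
  · rw [hij i j hji.symm]
    simp [hji]

end SchurConst

/-! ### Schur relations over a field. -/

section FieldSchur

variable {R A k ι : Type u} [CommRing R] [Ring A] [Algebra R A] [Field k] [Algebra R k]
  [Fintype ι] [DecidableEq ι] {τ : A →ₗ[R] R} {b b' : Module.Basis ι R A}

theorem casimir_eq_zero_of_not_iso (h : ∀ i j, τ (b' i * b j) = if i = j then 1 else 0)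
    {M N : FinMod k (k ⊗[R] A)} (hM : IsSimpleModule (k ⊗[R] A) M)
    (hN : IsSimpleModule (k ⊗[R] A) N) (hMN : ¬ Nonempty (M ≃ₗ[k ⊗[R] A] N)) :
    casimir b b' M N = 0 := by
  ext φ x
  rcases (casimirHom h φ).bijective_or_eq_zero with hb | h0
  · exact absurd ⟨LinearEquiv.ofBijective _ hb⟩ hMN
  · rw [← casimirHom_apply h, h0]
    rfl

/-- Existence of Schur elements of split simple modules. -/
theorem exists_hasSchurConst (h : ∀ i j, τ (b' i * b j) = if i = j then 1 else 0)
    (hτ : ∀ x y, τ (x * y) = τ (y * x)) {M : FinMod k (k ⊗[R] A)} [Nontrivial M]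
    (hM : ∀ φ : M →ₗ[k] M, ∃ y : k ⊗[R] A, ∀ x : M, y • x = φ x) :
    ∃ c, HasSchurConst b b' M c := by
  have h1 : ∀ φ : M →ₗ[k] M, ∃ d : k, casimir b b' M M φ = d • LinearMap.id := fun φ ↦ by
    obtain ⟨d, hd⟩ := end_eq_smul_of_forall_exists_smul hM (casimirHom h φ)
    exact ⟨d, LinearMap.ext hd⟩
  have h2 : ∀ φ ψ : M →ₗ[k] M,
      casimir b b' M M (φ ∘ₗ ψ) = casimir b b' M M (ψ ∘ₗ φ) := fun φ ψ ↦ by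
    obtain ⟨y, hy⟩ := hM ψ
    have : ψ = Algebra.lsmul k k M y := LinearMap.ext fun x ↦ (hy x).symm
    rw [this, casimir_comp_lsmul h hτ]
  obtain ⟨x, hx⟩ := exists_ne (0 : M)
  obtain ⟨f, hf⟩ := Module.Projective.exists_dual_eq_one k hx
  obtain ⟨c, hc⟩ := h1 (f.smulRight x)
  -- Factor `g.smulRight z` through the line of `x` and swap the factors: the result is `g z` times
  -- the trace-one map `f.smulRight x`, whose Casimir value defines `c`.
  have h3 : ∀ (g : M →ₗ[k] k) (z : M),
      casimir b b' M M (g.smulRight z) = (c * g z) • LinearMap.id := fun g z ↦ by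
    have e1 : g.smulRight z = f.smulRight z ∘ₗ g.smulRight x := by
      ext v
      simp [hf]
    have e2 : g.smulRight x ∘ₗ f.smulRight z = g z • f.smulRight x := by
      ext v
      simp [smul_smul, mul_comm]
    rw [e1, h2, e2, map_smul, hc, smul_smul, mul_comm]
  refine ⟨c, fun φ ↦ ?_⟩
  rw [end_eq_sum_smulRight (Module.Free.chooseBasis k M) φ, map_sum, map_sum, Finset.mul_sum,
    Finset.sum_smul]
  exact Finset.sum_congr rfl fun i _ ↦ by rw [h3, LinearMap.trace_smulRight]

/-- The Casimir operator does not vanish on the simple modules of a split semisimple algebra. -/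
theorem exists_casimir_ne_zero (h : ∀ i j, τ (b' i * b j) = if i = j then 1 else 0)
    {I : Type v} {T : I → FinMod k (k ⊗[R] A)}
    (hT : ∀ i, IsSimpleModule (k ⊗[R] A) (T i)) (hinj : Function.Injective (repMap T))
    (hiso : ∀ i j, Nonempty (T i ≃ₗ[k ⊗[R] A] T j) → i = j) (i : I) :
    ∃ ψ : T i →ₗ[k] T i, casimir b b' (T i) (T i) ψ ≠ 0 := by
  by_contra! hcon
  have := (hT i).nontrivial
  obtain ⟨x, hx⟩ := exists_ne (0 : T i)
  obtain ⟨f, hf⟩ := Module.Projective.exists_dual_eq_one k hx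
  -- If the Casimir operator vanished on `T i`, this element would act by zero on every `T j`, hence
  -- be zero by faithfulness.
  have h0 : coeffElt b b' (T i) f x = 0 := by
    refine hinj ?_
    rw [map_zero]
    ext j z
    rw [repMap_apply, coeffElt_smul]
    rcases eq_or_ne i j with rfl | hij
    · rw [hcon]
      rfl
    · rw [casimir_eq_zero_of_not_iso h (hT i) (hT j) fun e ↦ hij (hiso _ _ e)]
      rfl
  -- These are its coordinates in the basis `b`. Since `1` is a combination of the `b' j`, also `f x
  -- = 0`, against the choice of `f`.
  have h1 : ∀ j, f (act (T i) (b' j) x) = 0 := by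
    have h2 : ∑ j, f (act (T i) (b' j) x) • b.baseChange k j = 0 := by
      rw [← h0, coeffElt]
      exact Finset.sum_congr rfl fun j _ ↦ by
        rw [Module.Basis.baseChange_apply, TensorProduct.smul_tmul', smul_eq_mul, mul_one]
    exact Fintype.linearIndependent_iff.1 (b.baseChange k).linearIndependent _ h2
  have h2 : f (act (T i) 1 x) = 0 := by
    rw [← b'.sum_repr 1, map_sum, LinearMap.sum_apply, map_sum]
    refine Finset.sum_eq_zero fun j _ ↦ ?_
    rw [act_smul, LinearMap.smul_apply, map_smul, h1, smul_zero]
  rw [map_one, Module.End.one_apply, hf] at h2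
  exact one_ne_zero h2

end FieldSchur

/-- A linear retraction `π` of `f`, not necessarily `A`-linear, extends `ψ` to `f ∘ ψ ∘ π` on `X`;
restricted along `f`, its Casimir image is `f` composed with that of `ψ`. -/
theorem casimir_ne_zero_of_injective {R A k L ι : Type u} [CommRing R] [Ring A] [Algebra R A]
    [Field k] [Algebra R k] [Fintype ι] {b b' : ι → A} [Field L] [Algebra R L] [Algebra k L]
    [IsScalarTower R k L] {T : FinMod k (k ⊗[R] A)} {X : FinMod L (L ⊗[R] A)}
    (f : T.baseChange L →ₗ[L ⊗[R] A] X) (hf : Function.Injective f) {ψ : T →ₗ[k] T}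
    (hψ : casimir b b' T T ψ ≠ 0) : casimir b b' X X ≠ 0 := by
  intro h0
  apply hψ
  obtain ⟨π, hπ⟩ := (f.restrictScalars L).exists_leftInverse_of_injective
    (LinearMap.ker_eq_bot.2 hf)
  have h1 : casimir b b' X X (f.restrictScalars L ∘ₗ FinMod.map L ψ ∘ₗ π) = 0 := by
    rw [h0, LinearMap.zero_apply]
  have h2 : f.restrictScalars L ∘ₗ FinMod.map L (casimir b b' T T ψ) = 0 := by
    rw [← casimir_map, comp_casimir]
    have h3 : f.restrictScalars L ∘ₗ FinMod.map L ψ =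
        (f.restrictScalars L ∘ₗ FinMod.map L ψ ∘ₗ π) ∘ₗ f.restrictScalars L := by
      rw [LinearMap.comp_assoc, LinearMap.comp_assoc, hπ, LinearMap.comp_id]
    rw [h3, ← casimir_comp, h1, LinearMap.zero_comp]
  ext x
  have h3 : f (FinMod.map L (casimir b b' T T ψ) (T.incl L x)) = 0 :=
    LinearMap.congr_fun h2 (T.incl L x)
  rw [FinMod.map_incl] at h3
  have h4 := hf (h3.trans (map_zero f).symm)
  exact FinMod.incl_injective (algebraMap k L).injective (h4.trans FinMod.incl_zero.symm)

end DecompositionMap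
namespace DecompositionMap

/-! ### Valuation rings and lattices -/

section Valuation

variable {R K : Type u} [CommRing R] [Field K] [Algebra R K]

/-- A valuation subring containing `R`, as an `R`-subalgebra. -/
def valuationSubalgebra (V : ValuationSubring K) (h : ∀ r, algebraMap R K r ∈ V) :
    Subalgebra R K where
  __ := V.toSubring
  algebraMap_mem' := h

theorem valuationRing_valuationSubalgebra [IsDomain R] [IsFractionRing R K]
    (V : ValuationSubring K) (h : ∀ r, algebraMap R K r ∈ V) :
    ValuationRing (valuationSubalgebra V h) := by
  rw [ValuationRing.iff_isInteger_or_isInteger _ K]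
  intro x
  rcases V.mem_or_inv_mem x with hx | hx
  · exact Or.inl ⟨⟨x, hx⟩, rfl⟩
  · exact Or.inr ⟨⟨x⁻¹, hx⟩, rfl⟩

/-- Every prime is the center of a valuation ring. -/
theorem exists_valuationRing_comap_eq [IsDomain R] [IsFractionRing R K] (p : PrimeSpectrum R) :
    ∃ (O : Subalgebra R K) (_ : ValuationRing O),
      (IsLocalRing.maximalIdeal O).comap (algebraMap R O) = p.asIdeal := by
  have hunit : ∀ y : p.asIdeal.primeCompl, IsUnit (algebraMap R K y) := fun y ↦ by
    refine IsUnit.mk0 _ fun h ↦ y.2 ?_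
    rw [FaithfulSMul.algebraMap_eq_zero_iff] at h
    rw [h]
    exact p.asIdeal.zero_mem
  let f : Localization.AtPrime p.asIdeal →+* K := IsLocalization.lift hunit
  have hf : ∀ r, f (algebraMap R _ r) = algebraMap R K r := fun r ↦ IsLocalization.lift_eq _ _
  -- The valuation ring dominates the localization: the map into it is local, so its units pull back
  -- to the complement of `𝔭`.
  obtain ⟨V, hV, hloc⟩ := IsLocalRing.exists_factor_valuationRing f
  have hR : ∀ r, algebraMap R K r ∈ V := fun r ↦ hf r ▸ hV (algebraMap R _ r)
  have hval := valuationRing_valuationSubalgebra V hR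
  refine ⟨valuationSubalgebra V hR, hval, ?_⟩
  ext r
  rw [Ideal.mem_comap, IsLocalRing.mem_maximalIdeal, mem_nonunits_iff, ← not_iff_not, not_not]
  have h1 : r ∉ p.asIdeal ↔ IsUnit (algebraMap R (Localization.AtPrime p.asIdeal) r) :=
    (IsLocalization.AtPrime.isUnit_to_map_iff _ p.asIdeal r).symm
  have h2 : IsUnit (algebraMap R (Localization.AtPrime p.asIdeal) r) ↔
      IsUnit (f.codRestrict V.toSubring hV (algebraMap R _ r)) :=
    (isUnit_map_iff (f.codRestrict V.toSubring hV) _).symm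
  rw [h1, h2, isUnit_iff_exists_inv, isUnit_iff_exists_inv]
  constructor
  · rintro ⟨y, hy⟩
    refine ⟨⟨y.1, y.2⟩, Subtype.ext ?_⟩
    have := congrArg Subtype.val hy
    change f (algebraMap R _ r) * y.1 = 1
    rw [hf]
    exact this
  · rintro ⟨y, hy⟩
    refine ⟨⟨y.1, y.2⟩, Subtype.ext ?_⟩
    have := congrArg Subtype.val hy
    change f (algebraMap R _ r) * y.1 = 1 at this
    rw [hf] at this
    exact this

/-- An element of `K` lying in all valuation rings containing the normal ring `R` lies in `R`. -/
theorem exists_eq_algebraMap_of_forall_valuationRing [IsDomain R] [IsIntegrallyClosed R]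
    [IsFractionRing R K] (x : K)
    (hx : ∀ O : Subalgebra R K, ValuationRing O → x ∈ O) : ∃ r, algebraMap R K r = x := by
  rw [← IsIntegrallyClosed.isIntegral_iff]
  have : IsIntegrallyClosedIn (integralClosure R K).toSubring K :=
    inferInstanceAs (IsIntegrallyClosedIn (integralClosure R K) K)
  change x ∈ (integralClosure R K).toSubring
  rw [Subring.eq_iInf_of_isIntegrallyClosedIn (R := (integralClosure R K).toSubring),
    Subring.mem_iInf]
  rintro ⟨V, hV⟩
  have hR : ∀ r, algebraMap R K r ∈ V := fun r ↦ hV ((integralClosure R K).algebraMap_mem r)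
  exact hx (valuationSubalgebra V hR) (valuationRing_valuationSubalgebra V hR)

end Valuation

/-! ### Free forms over valuation rings and integrality of Schur elements. -/

section Forms

variable {R A K : Type u} [CommRing R] [Field K] [Algebra R K] [Ring A] [Algebra R A]

/-- Every `A^K`-module contains a full `A^O`-lattice. -/
theorem exists_lattice [Module.Finite R A] (O : Subalgebra R K) (V : FinMod K (K ⊗[R] A)) :
    ∃ (W : FinMod O (O ⊗[R] A)) (f : W →ₗ[O] V), Function.Injective f ∧
      (∀ a x, f (act W a x) = act V a (f x)) ∧ Submodule.span K (Set.range f) = ⊤ := by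
  let _ : Module (O ⊗[R] A) V := Module.compHom V (extAlg R A O K).toRingHom
  have hsm : ∀ (y : O ⊗[R] A) (x : V), y • x = extAlg R A O K y • x := fun _ _ ↦ rfl
  have : IsScalarTower O (O ⊗[R] A) V := ⟨fun s y x ↦ by
    rw [hsm, hsm, extAlg_smul, smul_assoc, algebraMap_smul]⟩
  let v := Module.Free.chooseBasis K V
  -- The `A^O`-span of a `K`-basis is finite over `O`, because `A` is finite over `R`.
  let N : Submodule (O ⊗[R] A) V := Submodule.span _ (Set.range v)
  have hN : Module.Finite (O ⊗[R] A) N := Module.Finite.span_of_finite _ (Set.finite_range v)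
  refine ⟨{ carrier := N, finite := Module.Finite.trans (O ⊗[R] A) N },
    N.subtype.restrictScalars O, N.subtype_injective, fun a x ↦ ?_, ?_⟩
  · change ((1 : O) ⊗ₜ[R] a) • N.subtype x = ((1 : K) ⊗ₜ[R] a) • N.subtype x
    rw [hsm, extAlg_tmul, map_one]
  · rw [eq_top_iff, ← v.span_eq, Submodule.span_le]
    rintro _ ⟨i, rfl⟩
    exact Submodule.subset_span ⟨⟨v i, Submodule.subset_span ⟨i, rfl⟩⟩, rfl⟩

/-- Over a valuation ring with fraction field `K`, every `A^K`-module has a free form. -/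
theorem exists_isFreeForm [Module.Finite R A] (O : Subalgebra R K) [ValuationRing O]
    [IsFractionRing O K] (V : FinMod K (K ⊗[R] A)) :
    ∃ W : FinMod O (O ⊗[R] A), IsFreeForm O W V := by
  obtain ⟨W, f, hf, hfact, hfspan⟩ := exists_lattice O V
  have htors : Module.IsTorsionFree O W := by
    refine Module.IsTorsionFree.of_smul_eq_zero fun s x hsx ↦ ?_
    have h1 : (s : K) • f x = 0 := by
      have := congrArg f hsx
      rwa [map_smul, map_zero] at this
    rcases smul_eq_zero.1 h1 with h2 | h2
    · exact Or.inl (Subtype.ext h2)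
    · exact Or.inr (hf (h2.trans (map_zero f).symm))
  -- A valuation ring is a Bézout domain, so torsion-free modules are flat; finite flat modules over
  -- a local ring are free.
  have hflat : Module.Flat O W :=
    Module.Flat.flat_iff_torsion_eq_bot_of_isBezout.2
      (Submodule.isTorsionFree_iff_torsion_eq_bot.1 htors)
  have hfree : Module.Free O W := Module.free_of_flat_of_isLocalRing
  refine ⟨W, hfree, ?_⟩
  let w := Module.Free.chooseBasis O W
  have hli : LinearIndependent K (fun i ↦ f (w i)) := by
    rw [← LinearIndependent.iff_fractionRing O K]
    exact w.linearIndependent.map' f (LinearMap.ker_eq_bot.2 hf)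
  have hspan : ⊤ ≤ Submodule.span K (Set.range fun i ↦ f (w i)) := by
    rw [← hfspan, Submodule.span_le]
    rintro _ ⟨x, rfl⟩
    rw [← w.sum_repr x, map_sum]
    refine Submodule.sum_mem _ fun i _ ↦ ?_
    rw [map_smul]
    exact Submodule.smul_mem _ ((w.repr x i : O) : K) (Submodule.subset_span ⟨i, rfl⟩)
  let e : W.baseChange K ≃ₗ[K] V :=
    (FinMod.basis (S' := K) w).equiv (Module.Basis.mk hli hspan) (Equiv.refl _)
  have he : ∀ x, e (W.incl K x) = f x := fun x ↦ by
    rw [← w.sum_repr x, FinMod.incl_sum, map_sum, map_sum]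
    refine Finset.sum_congr rfl fun i _ ↦ ?_
    rw [FinMod.incl_smul, map_smul, ← FinMod.basis_apply, Module.Basis.equiv_apply,
      Module.Basis.mk_apply, Equiv.refl_apply, map_smul, algebraMap_smul]
  have hact : ∀ a z, e (act (W.baseChange K) a z) = act V a (e z) := fun a z ↦ by
    induction z using FinMod.induction_incl with
    | hincl x => rw [FinMod.act_incl, he, he, hfact]
    | hadd x y hx hy => simp only [map_add, hx, hy]
    | hsmul s x hx => simp only [map_smul, hx]
  exact ⟨LinearEquiv.ofBijective (homOfAct e.toLinearMap hact) e.bijective⟩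

theorem IsFreeForm.finrank_eq {O : Subalgebra R K} {W : FinMod O (O ⊗[R] A)}
    {V : FinMod K (K ⊗[R] A)} (h : IsFreeForm O W V) :
    Module.finrank K V = Module.finrank O W := by
  have := h.1
  obtain ⟨e⟩ := h.2
  rw [← (e.restrictScalars K).finrank_eq, FinMod.finrank_baseChange]

theorem IsFreeForm.hasSchurConst {ι : Type u} [Fintype ι] {b b' : ι → A} {O : Subalgebra R K}
    {W : FinMod O (O ⊗[R] A)} {V : FinMod K (K ⊗[R] A)} (h : IsFreeForm O W V) {c : O}
    (hV : HasSchurConst b b' V (c : K)) : HasSchurConst b b' W c := by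
  have := h.1
  obtain ⟨e⟩ := h.2
  exact HasSchurConst.of_baseChange (S' := K) Subtype.val_injective (hV.congr e.symm)

theorem IsFreeForm.casimir_eq_zero {ι : Type u} [Fintype ι] {b b' : ι → A} {O : Subalgebra R K}
    {W W' : FinMod O (O ⊗[R] A)} {V V' : FinMod K (K ⊗[R] A)} (h : IsFreeForm O W V)
    (h' : IsFreeForm O W' V') (hV : casimir b b' V V' = 0) : casimir b b' W W' = 0 := by
  have := h'.1
  obtain ⟨e⟩ := h.2
  obtain ⟨e'⟩ := h'.2
  exact casimir_eq_zero_of_baseChange (S' := K) Subtype.val_injective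
    (casimir_eq_zero_congr e.symm e'.symm hV)

/-- Schur elements lie in every ring over which the module has a free form. -/
theorem IsFreeForm.schurConst_mem {ι : Type u} [Fintype ι] {b b' : ι → A} {O : Subalgebra R K}
    {W : FinMod O (O ⊗[R] A)} {V : FinMod K (K ⊗[R] A)} [Nontrivial V] (h : IsFreeForm O W V)
    {c : K} (hV : HasSchurConst b b' V c) : c ∈ O := by
  have := h.1
  obtain ⟨e⟩ := h.2
  have hW := hV.congr e.symm
  let w := Module.Free.chooseBasis O W
  have : Nontrivial (W.baseChange K) := e.toEquiv.nontrivial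
  obtain ⟨i⟩ := (FinMod.basis (S' := K) w).index_nonempty
  -- The rank-one map has trace one, so the Casimir operator multiplies `w i` by `c`; as it
  -- preserves the lattice, the coordinate `c` lies in `O`.
  have h1 := LinearMap.congr_fun (hW (FinMod.map K ((w.coord i).smulRight (w i))))
    (W.incl K (w i))
  rw [casimir_map, trace_map, LinearMap.trace_smulRight, FinMod.map_incl, LinearMap.smul_apply,
    LinearMap.id_apply, Module.Basis.coord_apply, Module.Basis.repr_self, Finsupp.single_eq_same,
    map_one, mul_one, ← FinMod.basis_apply] at h1
  have h2 := congrArg (fun z ↦ (FinMod.basis (S' := K) w).repr z i) h1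
  simp only [map_smul, Module.Basis.repr_self, Finsupp.smul_single, Finsupp.single_eq_same,
    smul_eq_mul, mul_one] at h2
  rw [← h2]
  change (w.baseChange K).repr ((1 : K) ⊗ₜ _) i ∈ O
  rw [Module.Basis.baseChange_repr_tmul, Algebra.smul_def, mul_one]
  exact Subtype.prop _

/-- The Schur elements over the fraction field of a normal domain lie in the domain. -/
theorem exists_schurConst_eq_algebraMap [IsDomain R] [IsIntegrallyClosed R] [IsFractionRing R K]
    [Module.Finite R A] {ι : Type u} [Fintype ι] {b b' : ι → A} {V : FinMod K (K ⊗[R] A)}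
    [Nontrivial V] {c : K} (hV : HasSchurConst b b' V c) : ∃ r, algebraMap R K r = c := by
  refine exists_eq_algebraMap_of_forall_valuationRing c fun O hO ↦ ?_
  obtain ⟨W, hW⟩ := exists_isFreeForm O V
  exact hW.schurConst_mem hV

end Forms

/-! ### Gates -/

section Gates

variable {R A K : Type u} [CommRing R] [Field K] [Algebra R K] [Ring A] [Algebra R A]
  {p : PrimeSpectrum R} {O : Subalgebra R K} [IsLocalRing O]

theorem gamma_of (h : (IsLocalRing.maximalIdeal O).comap (algebraMap R O) = p.asIdeal)
    (T : FinMod p.asIdeal.ResidueField (p.asIdeal.ResidueField ⊗[R] A)) :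
    letI := (residueMap R p O h).toRingHom.toAlgebra
    haveI : IsScalarTower R p.asIdeal.ResidueField (IsLocalRing.ResidueField O) :=
      IsScalarTower.of_algebraMap_eq fun r ↦ ((residueMap R p O h).commutes r).symm
    gamma R A p O h (G0.of T) = G0.of (T.baseChange (IsLocalRing.ResidueField O)) := by
  let _ := (residueMap R p O h).toRingHom.toAlgebra
  have : IsScalarTower R p.asIdeal.ResidueField (IsLocalRing.ResidueField O) :=
    IsScalarTower.of_algebraMap_eq fun r ↦ ((residueMap R p O h).commutes r).symm
  exact G0.ext_of _ T

/-- Splitness makes `gamma` surjective, so the reduction condition in the definition of a gate is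
automatic. -/
theorem mem_range_gamma [Module.Finite R A]
    (hsplit : IsSplit p.asIdeal.ResidueField (p.asIdeal.ResidueField ⊗[R] A))
    (h : (IsLocalRing.maximalIdeal O).comap (algebraMap R O) = p.asIdeal)
    (M : FinMod (IsLocalRing.ResidueField O) (IsLocalRing.ResidueField O ⊗[R] A)) :
    G0.of M ∈ (gamma R A p O h).range := by
  let _ := (residueMap R p O h).toRingHom.toAlgebra
  have : IsScalarTower R p.asIdeal.ResidueField (IsLocalRing.ResidueField O) :=
    IsScalarTower.of_algebraMap_eq fun r ↦ ((residueMap R p O h).commutes r).symm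
  exact G0.ext_surjective _ hsplit M

/-- Gates exist in every prime over which the algebra splits. -/
theorem exists_isGate {R A K : Type u} [CommRing R] [Field K] [Algebra R K] [Ring A] [Algebra R A]
    [IsDomain R] [IsFractionRing R K] [Module.Finite R A] (p : PrimeSpectrum R)
    (hsplit : IsSplit p.asIdeal.ResidueField (p.asIdeal.ResidueField ⊗[R] A)) :
    ∃ O : Subalgebra R K, IsGate A p O := by
  obtain ⟨O, hO, hp⟩ := exists_valuationRing_comap_eq (K := K) p
  exact ⟨O, inferInstance, hp, exists_isFreeForm O, fun W _ ↦ mem_range_gamma hsplit hp _⟩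

/-- If `A` has split fibers, then its generic fiber splits. -/
theorem HasSplitFibers.isSplit {R A : Type u} (K : Type u) [CommRing R] [IsDomain R] [Field K]
    [Algebra R K] [IsFractionRing R K] [Ring A] [Algebra R A] [Module.Finite R A]
    (hsplit : HasSplitFibers R A) : IsSplit K (K ⊗[R] A) := by
  -- The residue field of the zero ideal maps to `K`, and splitness passes up field extensions.
  let p : PrimeSpectrum R := ⟨⊥, Ideal.isPrime_bot⟩
  let f : p.asIdeal.ResidueField →ₐ[R] K :=
    Ideal.ResidueField.liftₐ p.asIdeal (Algebra.ofId R K) bot_le (by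
      intro r hr
      refine IsUnit.mk0 _ fun h ↦ hr ?_
      exact (FaithfulSMul.algebraMap_eq_zero_iff R K).1 h)
  let _ := f.toRingHom.toAlgebra
  have : IsScalarTower R p.asIdeal.ResidueField K :=
    IsScalarTower.of_algebraMap_eq fun r ↦ (f.commutes r).symm
  exact (hsplit p).baseChange K

end Gates

end DecompositionMap
namespace DecompositionMap

/-! ### Ranks of idempotents and classes in the Grothendieck group -/

section Classes

variable {k B : Type u} [Field k] [Ring B] [Algebra k B] {I : Type v}

theorem rankOn_eq_one {e : B} {M : FinMod k B} {v : M} (hv : v ≠ 0) (h1 : e • v = v)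
    (h2 : ∀ x : M, ∃ c : k, e • x = c • v) : rankOn e M = 1 := by
  have h : LinearMap.range (Algebra.lsmul k k M e) = Submodule.span k {v} := by
    refine le_antisymm ?_ ?_
    · rintro _ ⟨x, rfl⟩
      obtain ⟨c, hc⟩ := h2 x
      exact Submodule.mem_span_singleton.2 ⟨c, hc.symm⟩
    · rw [Submodule.span_singleton_le_iff_mem]
      exact ⟨v, h1⟩
  rw [rankOn, h, finrank_span_singleton hv]

/-- Non-isomorphic simple modules of a split semisimple algebra have different classes. -/
theorem class_injective {M : I → FinMod k B} (hM : Function.Bijective (repMap M))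
    (hne : ∀ i, Nontrivial (M i)) {i j : I} (h : G0.of (M i) = G0.of (M j)) : i = j := by
  classical
  by_contra hij
  -- The idempotent that is the identity on `M i` and zero elsewhere; its rank separates the two
  -- classes.
  obtain ⟨e, he⟩ := hM.2 (Pi.single i LinearMap.id)
  have hi : ∀ x : M i, e • x = x := fun x ↦ by
    rw [← repMap_apply, he, Pi.single_eq_same, LinearMap.id_apply]
  have hj : ∀ l, l ≠ i → ∀ x : M l, e • x = 0 := fun l hl x ↦ by
    rw [← repMap_apply, he, Pi.single_eq_of_ne hl, LinearMap.zero_apply]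
  have hidem : IsIdempotentElem e := by
    refine hM.1 (funext fun l ↦ LinearMap.ext fun x ↦ ?_)
    rw [repMap_apply, repMap_apply, mul_smul]
    rcases eq_or_ne l i with rfl | hl
    · rw [hi, hi]
    · rw [hj l hl, hj l hl]
  have h1 := congrArg (rankHom (k := k) hidem) h
  rw [rankHom_of, rankHom_of, rankOn_eq_zero (hj j (Ne.symm hij)), Nat.cast_inj] at h1
  have h2 : Algebra.lsmul k k (M i) e = LinearMap.id := LinearMap.ext hi
  rw [rankOn, h2, LinearMap.range_id, finrank_top] at h1
  exact (Module.finrank_pos (R := k) (M := M i)).ne' h1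

/-- Expansion of a class in terms of the classes of simple modules, the coefficients being
the ranks of suitable idempotents. -/
theorem class_eq_sum [Fintype I] [DecidableEq I] {M : I → FinMod k B}
    (hall : ∀ X : FinMod k B, IsSimpleModule B X → ∃ i, Nonempty (M i ≃ₗ[B] X))
    {e : I → B} (he : ∀ i, IsIdempotentElem (e i))
    (hr : ∀ i j, rankOn (e i) (M j) = if i = j then 1 else 0) (X : FinMod k B) :
    G0.of X = ∑ i, (rankOn (e i) X : ℤ) • G0.of (M i) := by
  let F : G0 k B →+ G0 k B := ∑ i, (zmultiplesHom _ (G0.of (M i))).comp (rankHom (he i))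
  have hF : ∀ Y, F (G0.of Y) = ∑ i, (rankOn (e i) Y : ℤ) • G0.of (M i) := fun Y ↦ by
    simp [F, rankHom_of]
  have hmem : G0.of X ∈ AddMonoidHom.eqLocus (AddMonoidHom.id _) F := by
    refine G0.of_mem_closure _ ?_ X
    rintro _ ⟨Y, hY, rfl⟩
    obtain ⟨j, ⟨f⟩⟩ := hall Y hY
    change G0.of Y = F (G0.of Y)
    rw [← G0.of_congr f, hF, Finset.sum_eq_single j]
    · simp [hr]
    · intro i _ hij
      simp [hr, hij]
    · simp
  exact hmem.trans (hF X)

theorem repMap_injective_congr {S B : Type u} [CommRing S] [Ring B] [Algebra S B]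
    {M N : I → FinMod S B} (e : ∀ i, M i ≃ₗ[B] N i)
    (hM : Function.Injective (repMap M)) : Function.Injective (repMap N) := by
  intro x y hxy
  refine hM (funext fun i ↦ LinearMap.ext fun z ↦ ?_)
  rw [repMap_apply, repMap_apply]
  refine (e i).injective ?_
  rw [map_smul, map_smul]
  exact LinearMap.congr_fun (congrFun hxy i) (e i z)

end Classes

/-! ### Idempotents over a local ring and their ranks after extension. -/

section Reduction

variable {R A S : Type u} [CommRing R] [Ring A] [Algebra R A] [CommRing S] [Algebra R S]

theorem lsmul_extAlg {S' : Type u} [CommRing S'] [Algebra R S'] [Algebra S S']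
    [IsScalarTower R S S'] (W : FinMod S (S ⊗[R] A)) (y : S ⊗[R] A) :
    Algebra.lsmul S' S' (W.baseChange S') (extAlg R A S S' y) =
      FinMod.map S' (Algebra.lsmul S S W y) :=
  FinMod.hom_ext_incl fun x ↦ by
    rw [FinMod.map_incl]
    exact FinMod.extAlg_smul_incl y x

/-- The rank of an idempotent on a free module over a local ring is invariant under extension to
a field. -/
theorem rankOn_baseChange [IsLocalRing S] {F : Type u} [Field F] [Algebra R F] [Algebra S F]
    [IsScalarTower R S F] {e : S ⊗[R] A} (he : IsIdempotentElem e) (W : FinMod S (S ⊗[R] A))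
    [Module.Free S W] : rankOn (extAlg R A S F e) (W.baseChange F) =
      Module.finrank S (LinearMap.range (Algebra.lsmul S S W e)) := by
  let φ : W →ₗ[S] W := Algebra.lsmul S S W e
  have hφ : ∀ x, φ (φ x) = φ x := fun x ↦ by
    change e • e • x = e • x
    rw [smul_smul, he.eq]
  let P := LinearMap.range φ
  let q : W →ₗ[S] P := φ.rangeRestrict
  have hq : q ∘ₗ P.subtype = LinearMap.id := by
    ext ⟨_, x, rfl⟩
    exact hφ x
  -- The image of an idempotent is a direct summand, hence free over the local ring, and its
  -- formation commutes with any base change.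
  have hproj : Module.Projective S P := Module.Projective.of_split P.subtype q hq
  have hfin : Module.Finite S P := Module.Finite.range φ
  have hfree : Module.Free S P := Module.free_of_flat_of_isLocalRing
  have h1 : q.baseChange F ∘ₗ P.subtype.baseChange F = LinearMap.id := by
    rw [← LinearMap.baseChange_comp, hq, LinearMap.baseChange_id]
  have h2 : P.subtype.baseChange F ∘ₗ q.baseChange F = φ.baseChange F := by
    rw [← LinearMap.baseChange_comp]
    rfl
  have h3 : LinearMap.range (φ.baseChange F) = LinearMap.range (P.subtype.baseChange F) := by
    rw [← h2, LinearMap.range_comp_of_range_eq_top]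
    exact LinearMap.range_eq_top.2 (Function.LeftInverse.surjective
      (g := P.subtype.baseChange F) (LinearMap.congr_fun h1))
  have h4 : Function.Injective (P.subtype.baseChange F) :=
    Function.LeftInverse.injective (g := q.baseChange F) (LinearMap.congr_fun h1)
  rw [rankOn, lsmul_extAlg]
  change Module.finrank F (LinearMap.range (φ.baseChange F)) = Module.finrank S P
  rw [h3, LinearMap.finrank_range_of_inj h4, Module.finrank_baseChange]

/-- A family of idempotents acting with rank one on one member of a family and by zero on
the others. -/
theorem exists_idempotents [Module.Free R A] [Nontrivial S] {I : Type v} [DecidableEq I]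
    {W : I → FinMod S (S ⊗[R] A)} [∀ i, Module.Free S (W i)] (hne : ∀ i, Nontrivial (W i))
    (hsurj : Function.Surjective (repMap W)) {K : Type u} [Field K] [Algebra R K] [Algebra S K]
    [IsScalarTower R S K] (hSK : Function.Injective (algebraMap S K))
    (hinj : Function.Injective (repMap fun i ↦ (W i).baseChange K)) :
    ∃ e : I → S ⊗[R] A, (∀ i, IsIdempotentElem (e i)) ∧
      ∀ (F : Type u) [Field F] [Algebra R F] [Algebra S F] [IsScalarTower R S F] (i j : I),
        rankOn (extAlg R A S F (e i)) ((W j).baseChange F) = if i = j then 1 else 0 := by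
  have hidx : ∀ i, Nonempty (Module.Free.ChooseBasisIndex S (W i)) := fun i ↦
    (Module.Free.chooseBasis S (W i)).index_nonempty
  let s i := (hidx i).some
  let w i := Module.Free.chooseBasis S (W i)
  let φ : ∀ i, W i →ₗ[S] W i := fun i ↦ ((w i).coord (s i)).smulRight (w i (s i))
  choose e he using fun i ↦ hsurj (Pi.single i (φ i))
  have hi : ∀ i (x : W i), e i • x = φ i x := fun i x ↦ by
    rw [← repMap_apply, he, Pi.single_eq_same]
  have hj : ∀ i j, j ≠ i → ∀ x : W j, e i • x = 0 := fun i j hij x ↦ by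
    rw [← repMap_apply, he, Pi.single_eq_of_ne hij, LinearMap.zero_apply]
  refine ⟨e, fun i ↦ ?_, fun F _ _ _ _ i j ↦ ?_⟩
  -- Idempotency is tested in `A^K`, which contains `A^S` and acts faithfully on the extended
  -- family.
  · refine extAlg_injective K hSK (hinj (funext fun j ↦ FinMod.hom_ext_incl fun x ↦ ?_))
    rw [repMap_apply, repMap_apply, FinMod.extAlg_smul_incl, FinMod.extAlg_smul_incl, mul_smul]
    rcases eq_or_ne j i with rfl | hij
    · rw [hi, hi]
      simp [φ]
    · rw [hj i j hij, hj i j hij]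
  · split_ifs with hij
    · subst hij
      refine rankOn_eq_one (v := (W i).incl F (w i (s i))) ?_ ?_ fun z ↦ ?_
      · rw [← FinMod.basis_apply]
        exact Module.Basis.ne_zero _ _
      · rw [FinMod.extAlg_smul_incl, hi]
        simp [φ]
      · induction z using FinMod.induction_incl with
        | hincl x =>
          refine ⟨algebraMap S F ((w i).repr x (s i)), ?_⟩
          rw [FinMod.extAlg_smul_incl, hi, ← FinMod.incl_smul]
          simp [φ]
        | hadd x y hx hy =>
          obtain ⟨c, hc⟩ := hx
          obtain ⟨d, hd⟩ := hy
          exact ⟨c + d, by rw [smul_add, hc, hd, add_smul]⟩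
        | hsmul t x hx =>
          obtain ⟨c, hc⟩ := hx
          exact ⟨t * c, by rw [smul_comm, hc, mul_smul]⟩
    · refine rankOn_eq_zero fun z ↦ ?_
      induction z using FinMod.induction_incl with
      | hincl x => rw [FinMod.extAlg_smul_incl, hj i j (Ne.symm hij), FinMod.incl_zero]
      | hadd x y hx hy => rw [smul_add, hx, hy, add_zero]
      | hsmul t x hx => rw [smul_comm, hx, smul_zero]

end Reduction

/-! ### The main theorem -/

section Main

variable {R A K : Type u} [CommRing R] [IsDomain R] [Field K] [Algebra R K] [Ring A] [Algebra R A]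
  [Module.Free R A] [Module.Finite R A] {ι : Type u} [Fintype ι] [DecidableEq ι] {τ : A →ₗ[R] R}
  {b b' : Module.Basis ι R A} {I : Type v} [Fintype I] {V : I → FinMod K (K ⊗[R] A)} {c : I → R}
  {p : PrimeSpectrum R} {O : Subalgebra R K}

/-- If no Schur element lies in `𝔭`, then all decomposition maps in `𝔭` are trivial. -/
theorem hasTrivialDecompositionMap_of_notMem
    (hsplit : IsSplit p.asIdeal.ResidueField (p.asIdeal.ResidueField ⊗[R] A))
    (hτ : ∀ i j, τ (b' i * b j) = if i = j then 1 else 0)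
    (hV : IsSimpleSystem V) (hbij : Function.Bijective (repMap V))
    (hc : ∀ i, HasSchurConst b b' (V i) (algebraMap R K (c i))) (hO : IsGate A p O)
    (hcp : ∀ i, c i ∉ p.asIdeal) : HasTrivialDecompositionMap hO := by
  classical
  have hloc := hO.isLocalRing
  let k := p.asIdeal.ResidueField
  let L := IsLocalRing.ResidueField O
  let _ : Algebra k L := (residueMap R p O hO.comap_eq).toRingHom.toAlgebra
  have : IsScalarTower R k L :=
    IsScalarTower.of_algebraMap_eq fun r ↦ ((residueMap R p O hO.comap_eq).commutes r).symm
  have hγ : ∀ T : FinMod k (k ⊗[R] A),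
      gamma R A p O hO.comap_eq (G0.of T) = G0.of (T.baseChange L) := gamma_of hO.comap_eq
  choose W hW using fun i ↦ hO.exists_form (V i)
  have hfree : ∀ i, Module.Free O (W i) := fun i ↦ (hW i).1
  have hVne : ∀ i, Nontrivial (V i) := fun i ↦ (hV.simple i).nontrivial
  have hWpos : ∀ i, 0 < Module.finrank O (W i) := fun i ↦ by
    rw [← (hW i).finrank_eq]
    exact Module.finrank_pos
  have hWne : ∀ i, Nontrivial (W i) := fun i ↦
    Module.nontrivial_of_finrank_pos (R := O) (hWpos i)
  have hcunit : ∀ i, IsUnit (algebraMap R O (c i)) := fun i ↦ by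
    by_contra hcon
    refine hcp i ?_
    rw [← hO.comap_eq]
    exact hcon
  have hsurjW : Function.Surjective (repMap W) :=
    repMap_surjective_of_isUnit (b := b) (b' := b') hcunit (fun i ↦ (hW i).hasSchurConst (hc i))
      fun i j hij ↦ (hW i).casimir_eq_zero (hW j)
        (casimir_eq_zero_of_not_iso hτ (hV.simple i) (hV.simple j)
          fun e ↦ hij (hV.eq_of_iso i j e))
  let e : ∀ i, (W i).baseChange K ≃ₗ[K ⊗[R] A] V i := fun i ↦ (hW i).2.some
  have hinjK : Function.Injective (repMap fun i ↦ (W i).baseChange K) :=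
    repMap_injective_congr (fun i ↦ (e i).symm) hbij.1
  obtain ⟨ε, hε, hrank⟩ := exists_idempotents hWne hsurjW (K := K) Subtype.val_injective hinjK
  have hεK : ∀ i, IsIdempotentElem (extAlg R A O K (ε i)) := fun i ↦ (hε i).map _
  have hεL : ∀ i, IsIdempotentElem (extAlg R A O L (ε i)) := fun i ↦ (hε i).map _
  -- the reductions of the simple modules
  let Wbar : I → FinMod L (L ⊗[R] A) := fun i ↦ (W i).baseChange L
  have hsurjL : Function.Surjective (repMap Wbar) := repMap_baseChange_surjective L hsurjW
  have hWbarRank : ∀ i, Module.finrank L (Wbar i) = Module.finrank K (V i) := fun i ↦ by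
    rw [(hW i).finrank_eq]
    exact FinMod.finrank_baseChange
  have hWbarNe : ∀ i, Nontrivial (Wbar i) := fun i ↦
    Module.nontrivial_of_finrank_pos (R := L) (by
      rw [hWbarRank]
      exact Module.finrank_pos)
  have hWbarSimple : ∀ i, IsSimpleModule (L ⊗[R] A) (Wbar i) := fun i ↦
    isSimple_of_surjective hsurjL i
  have hsumK : ∑ i, Module.finrank K (V i) ^ 2 = Module.finrank R A := by
    rw [sum_sq_of_bijective hbij, Module.finrank_baseChange]
  have hsumL : ∑ i, Module.finrank L (Wbar i) ^ 2 = Module.finrank L (L ⊗[R] A) := by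
    simp only [hWbarRank]
    rw [hsumK, Module.finrank_baseChange]
  have hallL := exists_iso_of_sum_sq (hsplit.baseChange L) hWbarSimple
    (fun i j ↦ eq_of_iso_of_surjective hsurjL hWbarNe) hsumL
  -- the simple modules of the fiber
  choose T hT hTW using fun i ↦ exists_iso_baseChange L hsplit (Wbar i) (hWbarSimple i)
  have hTclass : ∀ i, gamma R A p O hO.comap_eq (G0.of (T i)) = G0.of (Wbar i) := fun i ↦ by
    rw [hγ, G0.of_congr (hTW i).some]
  have hTrank : ∀ i, Module.finrank k (T i) = Module.finrank K (V i) := fun i ↦ by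
    rw [← hWbarRank, ← finrank_eq_of_class_eq (G0.of_congr (hTW i).some)]
    exact FinMod.finrank_baseChange.symm
  have hTiso : ∀ i j, Nonempty (T i ≃ₗ[k ⊗[R] A] T j) → i = j := by
    rintro i j ⟨f⟩
    exact eq_of_iso_of_surjective hsurjL hWbarNe
      ⟨((hTW i).some.symm.trans (FinMod.congr f)).trans (hTW j).some⟩
  have hsumk : ∑ i, Module.finrank k (T i) ^ 2 = Module.finrank k (k ⊗[R] A) := by
    simp only [hTrank]
    rw [hsumK, Module.finrank_baseChange]
  have hallk := exists_iso_of_sum_sq hsplit hT hTiso hsumk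
  -- The rank of `ε i` over `K` is the multiplicity of `V i`, so this sends `[V i]` to `[T i]`.
  let d : G0 K (K ⊗[R] A) →+ G0 k (k ⊗[R] A) :=
    ∑ i, (zmultiplesHom _ (G0.of (T i))).comp (rankHom (hεK i))
  have hd : ∀ X, d (G0.of X) = ∑ i, (rankOn (extAlg R A O K (ε i)) X : ℤ) • G0.of (T i) :=
    fun X ↦ by simp [d, rankHom_of]
  have hdV : ∀ j, d (G0.of (V j)) = G0.of (T j) := fun j ↦ by
    rw [hd, Finset.sum_eq_single j]
    · rw [← rankOn_congr _ (e j), hrank K]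
      simp
    · intro i _ hij
      rw [← rankOn_congr _ (e j), hrank K]
      simp [hij]
    · simp
  refine ⟨d, ?_, ?_, ?_, ?_⟩
  -- For any free form `Y`, the rank of `ε i` is the same over `K` and over the residue field, so
  -- both expansions have equal coefficients. This also gives independence of the chosen form.
  · rintro X Y ⟨hYfree, ⟨f⟩⟩
    rw [hd, map_sum, reductionClass,
      class_eq_sum hallL hεL (fun i j ↦ hrank L i j) (Y.baseChange L)]
    refine Finset.sum_congr rfl fun i _ ↦ ?_
    rw [map_zsmul, hTclass, ← rankOn_congr _ f, rankOn_baseChange (hε i) Y,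
      rankOn_baseChange (hε i) Y]
  · rintro _ ⟨X, hX, rfl⟩
    obtain ⟨i, ⟨f⟩⟩ := hV.exists_iso X hX
    rw [← G0.of_congr f, hdV]
    exact ⟨T i, hT i, rfl⟩
  · rintro _ ⟨X, hX, rfl⟩ _ ⟨Y, hY, rfl⟩ hXY
    obtain ⟨i, ⟨f⟩⟩ := hV.exists_iso X hX
    obtain ⟨j, ⟨g⟩⟩ := hV.exists_iso Y hY
    rw [← G0.of_congr f, ← G0.of_congr g, hdV, hdV] at hXY
    have h1 := congrArg (gamma R A p O hO.comap_eq) hXY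
    rw [hTclass, hTclass] at h1
    have hij := class_injective (repMap_bijective_of_sum_sq hsurjL hsumL) hWbarNe h1
    subst hij
    rw [← G0.of_congr f, ← G0.of_congr g]
  · rintro _ ⟨X, hX, rfl⟩
    obtain ⟨i, ⟨f⟩⟩ := hallk X hX
    exact ⟨G0.of (V i), ⟨V i, hV.simple i, rfl⟩, by rw [hdV, G0.of_congr f]⟩

/-- If some decomposition map in `𝔭` is trivial, then no Schur element lies in `𝔭`. -/
theorem notMem_of_hasTrivialDecompositionMap
    (hsplit : IsSplit p.asIdeal.ResidueField (p.asIdeal.ResidueField ⊗[R] A))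
    (hτ : ∀ i j, τ (b' i * b j) = if i = j then 1 else 0)
    (hV : IsSimpleSystem V) (hbij : Function.Bijective (repMap V))
    (hc : ∀ i, HasSchurConst b b' (V i) (algebraMap R K (c i))) (hO : IsGate A p O)
    (htriv : HasTrivialDecompositionMap hO) (i : I) : c i ∉ p.asIdeal := by
  classical
  intro hcp
  have hloc := hO.isLocalRing
  let k := p.asIdeal.ResidueField
  let L := IsLocalRing.ResidueField O
  let _ : Algebra k L := (residueMap R p O hO.comap_eq).toRingHom.toAlgebra
  have : IsScalarTower R k L :=
    IsScalarTower.of_algebraMap_eq fun r ↦ ((residueMap R p O hO.comap_eq).commutes r).symm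
  have hγ : ∀ T : FinMod k (k ⊗[R] A),
      gamma R A p O hO.comap_eq (G0.of T) = G0.of (T.baseChange L) := gamma_of hO.comap_eq
  obtain ⟨d, hd, hdmaps, hdinj, -⟩ := htriv
  choose W hW using fun i ↦ hO.exists_form (V i)
  have hfree : ∀ i, Module.Free O (W i) := fun i ↦ (hW i).1
  have hVne : ∀ i, Nontrivial (V i) := fun i ↦ (hV.simple i).nontrivial
  choose T hT hdT using fun i ↦ hdmaps ⟨V i, hV.simple i, rfl⟩
  -- Passing to a free form, reducing it and extending scalars all preserve dimension, which depends
  -- only on the class.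
  have hTrank : ∀ i, Module.finrank k (T i) = Module.finrank K (V i) := fun i ↦ by
    have h1 := hd (V i) (W i) (hW i)
    rw [hdT, hγ, reductionClass] at h1
    have h2 := finrank_eq_of_class_eq h1
    rw [(hW i).finrank_eq]
    rw [FinMod.finrank_baseChange, FinMod.finrank_baseChange] at h2
    exact h2
  have hTiso : ∀ i j, Nonempty (T i ≃ₗ[k ⊗[R] A] T j) → i = j := by
    rintro i j ⟨f⟩
    refine class_injective hbij hVne (hdinj ⟨_, hV.simple i, rfl⟩ ⟨_, hV.simple j, rfl⟩ ?_)
    rw [hdT, hdT, G0.of_congr f]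
  have hsum : ∑ i, Module.finrank k (T i) ^ 2 = Module.finrank k (k ⊗[R] A) := by
    simp only [hTrank]
    rw [sum_sq_of_bijective hbij, Module.finrank_baseChange, Module.finrank_baseChange]
  have hTbij : Function.Bijective (repMap T) :=
    repMap_bijective_of_sum_sq (repMap_surjective_of_isSplit hsplit hT hTiso) hsum
  -- the Casimir operator vanishes on the reduction of `V i`
  let X : FinMod L (L ⊗[R] A) := (W i).baseChange L
  have hXpos : 0 < Module.finrank L X := by
    have h1 : Module.finrank L X = Module.finrank O (W i) := FinMod.finrank_baseChange
    rw [h1, ← (hW i).finrank_eq]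
    exact Module.finrank_pos
  have : Nontrivial X := Module.nontrivial_of_finrank_pos (R := L) hXpos
  have hX : casimir b b' X X = 0 := by
    have h1 : HasSchurConst b b' (W i) (algebraMap R O (c i)) := (hW i).hasSchurConst (hc i)
    have h2 : HasSchurConst b b' X (algebraMap O L (algebraMap R O (c i))) := h1.baseChange
    have h3 : algebraMap O L (algebraMap R O (c i)) = 0 := by
      refine (IsLocalRing.residue_eq_zero_iff _).2 ?_
      rwa [← hO.comap_eq] at hcp
    ext1 φ
    rw [h2, h3, zero_mul, zero_smul, LinearMap.zero_apply]
  -- A simple submodule of the reduction descends to some `T j`, where the Casimir operator is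
  -- nonzero.
  obtain ⟨N, hN⟩ := X.exists_simple_submodule
  obtain ⟨T', hT', ⟨f⟩⟩ := exists_iso_baseChange L hsplit (X.sub N) hN
  obtain ⟨j, ⟨g⟩⟩ := exists_iso_of_sum_sq hsplit hT hTiso hsum T' hT'
  obtain ⟨ψ, hψ⟩ := exists_casimir_ne_zero hτ hT hTbij.1 hTiso j
  let F : (T j).baseChange L →ₗ[L ⊗[R] A] X :=
    X.subIncl N ∘ₗ ((FinMod.congr g).trans f).toLinearMap
  have hF : Function.Injective F :=
    (X.subIncl_injective N).comp ((FinMod.congr g).trans f).injective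
  exact casimir_ne_zero_of_injective F hF hψ hX

omit [IsDomain R] [Module.Free R A] [Module.Finite R A] [Fintype ι] in
theorem extendTrace_dual (hτ : ∀ i j, τ (b' i * b j) = if i = j then 1 else 0) (i j : ι) :
    extendTrace K τ (b'.baseChange K i * b.baseChange K j) = if i = j then 1 else 0 := by
  rw [Module.Basis.baseChange_apply, Module.Basis.baseChange_apply,
    Algebra.TensorProduct.tmul_mul_tmul, one_mul, extendTrace, LinearMap.comp_apply,
    LinearMap.baseChange_tmul, hτ]
  split_ifs <;> simp

omit [IsDomain R] [Module.Free R A] [Module.Finite R A] in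
/-- Comparison of the Casimir operators of two pairs of dual bases. -/
theorem sum_smul_eq_casimir (hτ : ∀ i j, τ (b' i * b j) = if i = j then 1 else 0) {n : ℕ}
    {β β' : Module.Basis (Fin n) K (K ⊗[R] A)}
    (hβ : ∀ i j, extendTrace K τ (β' i * β j) = if i = j then 1 else 0)
    {M : FinMod K (K ⊗[R] A)} (φ : M →ₗ[K] M) (x : M) :
    ∑ i, β i • φ (β' i • x) = casimir b b' M M φ x := by
  let Φ : (K ⊗[R] A) →ₗ[K] (K ⊗[R] A) →ₗ[K] M :=
    LinearMap.mk₂ K (fun y z ↦ y • φ (z • x))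
      (fun _ _ _ ↦ add_smul _ _ _) (fun _ _ _ ↦ smul_assoc _ _ _)
      (fun _ _ _ ↦ by rw [add_smul, map_add, smul_add])
      (fun _ _ _ ↦ by rw [smul_assoc, map_smul, smul_comm])
  have h := congrArg (TensorProduct.lift Φ)
    (casimirTensor_eq hβ (extendTrace_dual (K := K) hτ))
  simp only [map_sum, TensorProduct.lift.tmul] at h
  rw [casimir_apply]
  refine h.trans (Finset.sum_congr rfl fun i _ ↦ ?_)
  change b.baseChange K i • φ (b'.baseChange K i • x) = _
  rw [Module.Basis.baseChange_apply, Module.Basis.baseChange_apply]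
  rfl

omit [IsDomain R] [Module.Free R A] [Module.Finite R A] in
-- All dual bases give the same operator, so one fixed pair suffices; a trace-one map and a nonzero
-- vector pin down the scalar.
theorem isSchurElement_iff (hτ : ∀ i j, τ (b' i * b j) = if i = j then 1 else 0)
    {M : FinMod K (K ⊗[R] A)} [Nontrivial M] {c : K} (hM : HasSchurConst b b' M c) (x : K) :
    IsSchurElement (extendTrace K τ) M x ↔ x = c := by
  constructor
  · intro hx
    let e := Fintype.equivFin ι
    have hdual : ∀ i j, extendTrace K τ ((b'.baseChange K).reindex e i *
        (b.baseChange K).reindex e j) = if i = j then 1 else 0 := fun i j ↦ by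
      rw [Module.Basis.reindex_apply, Module.Basis.reindex_apply, extendTrace_dual hτ]
      simp
    obtain ⟨v, hv⟩ := exists_ne (0 : M)
    obtain ⟨f, hf⟩ := Module.Projective.exists_dual_eq_one K hv
    have h1 := hx _ _ _ hdual (f.smulRight v) v
    rw [sum_smul_eq_casimir hτ hdual, hM, LinearMap.trace_smulRight, hf, mul_one, mul_one,
      LinearMap.smul_apply, LinearMap.id_apply] at h1
    exact (smul_left_injective K hv h1).symm
  · rintro rfl n β β' hβ φ v
    rw [sum_smul_eq_casimir hτ hβ, hM]
    rfl

omit [IsDomain R] in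
/-- A symmetrizing trace admits dual bases. -/
theorem IsSymmetrizingTrace.exists_dual (hτ : IsSymmetrizingTrace τ) :
    ∃ (ι : Type u) (_ : Fintype ι) (_ : DecidableEq ι) (b b' : Module.Basis ι R A),
      ∀ i j, τ (b' i * b j) = if i = j then 1 else 0 := by
  classical
  let b := Module.Free.chooseBasis R A
  let f : A →ₗ[R] Module.Dual R A :=
    { toFun := fun a ↦ τ ∘ₗ LinearMap.mulLeft R a
      map_add' := fun x y ↦ by ext; simp [add_mul]
      map_smul' := fun r x ↦ by ext; simp }
  let e : A ≃ₗ[R] Module.Dual R A := LinearEquiv.ofBijective f hτ.bijective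
  -- The dual basis of linear forms is pulled back along `a ↦ τ (a * ·)`.
  refine ⟨_, inferInstance, inferInstance, b, b.dualBasis.map e.symm, fun i j ↦ ?_⟩
  change e (b.dualBasis.map e.symm i) (b j) = _
  rw [Module.Basis.map_apply, e.apply_symm_apply, Module.Basis.dualBasis_apply_self]
  simp only [eq_comm]

end Main

end DecompositionMap
theorem proposition2p4 {R K A : Type u}
    [CommRing R] [IsDomain R] [IsNoetherianRing R] [IsIntegrallyClosed R]
    [Field K] [Algebra R K] [IsFractionRing R K]
    [Ring A] [Algebra R A] [Module.Free R A] [Module.Finite R A]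
    (hsplit : DecompositionMap.HasSplitFibers R A)
    (τ : A →ₗ[R] R) (hτ : DecompositionMap.IsSymmetrizingTrace τ)
    (hss : IsSemisimpleRing (K ⊗[R] A))
    {I : Type v} [Fintype I] (S : I → DecompositionMap.FinMod K (K ⊗[R] A))
    (hS : DecompositionMap.IsSimpleSystem S) :
    ∃ c : I → R,
      (∀ i x, DecompositionMap.IsSchurElement (DecompositionMap.extendTrace K τ) (S i) x ↔
        x = algebraMap R K (c i)) ∧
      DecompositionMap.DecEx R A K = (⋃ i, PrimeSpectrum.zeroLocus {c i}) ∧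
      (⋃ i, PrimeSpectrum.zeroLocus {c i}) = PrimeSpectrum.zeroLocus {∏ i, c i} ∧
      DecompositionMap.IsDecompositionDiscriminant R A K (Ideal.span {∏ i, c i}) ∧
      ∀ d : Ideal R, DecompositionMap.IsDecompositionDiscriminant R A K d →
        d.radical = (Ideal.span {∏ i, c i}).radical := by
  open DecompositionMap in
  obtain ⟨ι, _, _, b, b', hb⟩ := hτ.exists_dual
  have hK : IsSplit K (K ⊗[R] A) := hsplit.isSplit K
  have hbij : Function.Bijective (repMap S) := repMap_bijective_of_isSemisimpleRing hK hss hS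
  have hne : ∀ i, Nontrivial (S i) := fun i ↦ (hS.simple i).nontrivial
  have hschur : ∀ i, ∃ r : R, HasSchurConst b b' (S i) (algebraMap R K r) := fun i ↦ by
    obtain ⟨x, hx⟩ := exists_hasSchurConst hb hτ.map_mul_comm
      (exists_smul_eq_of_surjective hbij.2 i)
    obtain ⟨r, rfl⟩ := exists_schurConst_eq_algebraMap hx
    exact ⟨r, hx⟩
  choose c hc using hschur
  have hDec : DecEx R A K = ⋃ i, PrimeSpectrum.zeroLocus {c i} := by
    ext p
    rw [DecEx, Set.mem_compl_iff, ← not_iff_not, not_not]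
    simp only [Set.mem_iUnion, PrimeSpectrum.mem_zeroLocus, Set.singleton_subset_iff,
      SetLike.mem_coe, not_exists]
    constructor
    · rintro ⟨⟨O, hO⟩, htriv⟩ i
      exact notMem_of_hasTrivialDecompositionMap (hsplit p) hb hS hbij hc hO (htriv O hO) i
    · intro hcp
      exact ⟨exists_isGate p (hsplit p), fun O hO ↦
        hasTrivialDecompositionMap_of_notMem (hsplit p) hb hS hbij hc hO hcp⟩
  have hprod : (⋃ i, PrimeSpectrum.zeroLocus {c i}) = PrimeSpectrum.zeroLocus {∏ i, c i} := by
    ext p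
    simp [PrimeSpectrum.mem_zeroLocus, p.isPrime.prod_mem_iff]
  have hdisc : IsDecompositionDiscriminant R A K (Ideal.span {∏ i, c i}) := by
    rw [IsDecompositionDiscriminant, PrimeSpectrum.zeroLocus_span, hDec, hprod]
  refine ⟨c, fun i x ↦ isSchurElement_iff hb (hc i) x, hDec, hprod, hdisc, fun d hd ↦ ?_⟩
  rw [← PrimeSpectrum.zeroLocus_eq_iff]
  exact Eq.trans hd (Eq.symm hdisc)
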